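/- **Setting.** Let $a<b$, $\theta=(a+b)/2$, $0<\varepsilon<(b-a)/2$, $\theta_{\pm\varepsilon}=\theta\pm\varepsilon$, and let $q$ be a real function, continuous on $[a,\theta_{-\varepsilon})$, $(\theta_{-\varepsilon},\theta_{+\varepsilon})$ and $(\theta_{+\varepsilon},b]$, with finite one-sided limits at $\theta_{\pm\varepsilon}$. Let $\beta_i,\alpha_i,\alpha_i',\delta,\gamma\in\mathbb R$ $(i=1,2)$ with $|\beta_1|+|\beta_2|\neq0$, $\delta\ne0$, $\gamma\neq0$ and $\rho=\alpha_1'\alpha_2-\alpha_1\alpha_2'>0$. Consider the eigenvalue problem $$-u''+q(x)u=\lambda u\quad\text{on }[a,\theta_{-\varepsilon})\cup(\theta_{-\varepsilon},\theta_{+\varepsilon})\cup(\theta_{+\varepsilon},b],$$ $$\beta_1u(a)+\beta_2u'(a)=0,\qquad \lambda\bigl(\alpha_1'u(b)-\alpha_2'u'(b)\bigr)+\bigl(\alpha_1u(b)-\alpha_2u'(b)\bigr)=0,$$ $$u^{(k)}(\theta_{-\varepsilon}-)=\delta u^{(k)}(\theta_{-\varepsilon}+),\qquad \delta u^{(k)}(\theta_{+\varepsilon}-)=\gamma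 u^{(k)}(\theta_{+\varepsilon}+)\qquad(k=0,1).$$ For $\lambda\in\mathbb C$ let $\phi_\lambda$, with restrictions $\phi_{-\varepsilon,\lambda},\phi_{\varepsilon,\lambda},\phi_{+\varepsilon,\lambda}$ to the three subintervals (from left to right), be the solution of the equation and of the four transmission conditions with $\phi_\lambda(a)=\beta_2$, $\phi_\lambda'(a)=-\beta_1$, and let $\chi_\lambda$ be the one with $\chi_\lambda(b)=\lambda\alpha_2'+\alpha_2$, $\chi_\lambda'(b)=\lambda\alpha_1'+\alpha_1$. Let $\omega(\lambda)=\phi_\lambda\chi_\lambda'-\phi_\lambda'\chi_\lambda$ be their Wronskian on $[a,\theta_{-\varepsilon})$, where it does not depend on $x$. **Theorem.** The function $\omega$ is entire, its zeros are real and simple, they are exactly the eigenvalues of the problem, and they form a sequence $\lambda_0<\lambda_1<\lambda_2<\cdots$. Let $g\in L_2(a,b)$ and $$F(\lambda)=\int_a^{\theta_{-\varepsilon}}g\,\phi_{-\varepsilon,\lambda}\,dx+\delta^2\int_{\theta_{-\varepsilon}}^{\theta_{+\varepsilon}}g\,\phi_{\varepsilon,\lambda}\,dx+\gamma^2\int_{\theta_{+\varepsilon}}^{b}g\,\phi_{+\varepsilon,\lambda}\,dx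 .$$ Then $F$ is an entire function of exponential type $b-a$, in the sense that $|F(\lambda)|\le Ce^{(b-a)|\lambda|}$ for all $\lambda\in\mathbb C$ with a constant $C$, and more precisely $|F(s^2)|\le C'e^{(b-a)|\operatorname{Im}s|}$ for all $s\in\mathbb C$ with a constant $C'$; and for every $\lambda\in\mathbb C$ $$F(\lambda)=\sum_{n=0}^\infty F(\lambda_n)\,\frac{\omega(\lambda)}{(\lambda-\lambda_n)\,\omega'(\lambda_n)},$$ where the quotient is understood as its limit $1$ at $\lambda=\lambda_n$. The series converges absolutely at every point of $\mathbb C$ and uniformly on compact subsets of $\mathbb C$. -/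

import Mathlib

open Set Filter Topology MeasureTheory

namespace SL

/-- `u` is a (classical) solution of `-u'' + q u = lam u` on the interval with end points `c < d`:
it is `C¹` up to the end points (so that the one-sided limits of `u` and `u'` there are the values
of `u` and of `derivWithin u (Icc c d)`), and the equation holds at every interior point. -/
structure IsSolution (q : ℝ → ℝ) (lam : ℂ) (c d : ℝ) (u : ℝ → ℂ) : Prop where
  contDiffOn : ContDiffOn ℝ 1 u (Icc c d)
  eqn : ∀ x ∈ Ioo c d, ∃ u'' : ℂ, HasDerivAt (deriv u) u'' x ∧
    -u'' + (q x : ℂ) * u x = lam * u x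

/-- A linear equation `w' = A w` with continuous bounded coefficient has a global solution. -/
theorem exists_linear_ode_solution {E : Type*} [NormedAddCommGroup E] [NormedSpace ℝ E]
    [CompleteSpace E] (A : ℝ → E →L[ℝ] E) (hA : Continuous A) (K : ℝ) (hK : ∀ t, ‖A t‖ ≤ K)
    (t₀ : ℝ) (w₀ : E) :
    ∃ w : ℝ → E, w t₀ = w₀ ∧ ∀ t, HasDerivAt w (A t (w t)) t := by
  have hK0 : 0 ≤ K := (norm_nonneg _).trans (hK 0)
  let W : ℕ → ℝ → E := fun n => Nat.rec (fun _ => w₀) (fun _ w t => ∫ s in t₀..t, A s (w s)) n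
  have W0 : ∀ t, W 0 t = w₀ := fun _ => rfl
  have WS : ∀ n t, W (n + 1) t = ∫ s in t₀..t, A s (W n s) := fun _ _ => rfl
  have Wc : ∀ n, Continuous (W n) := by
    intro n
    induction n with
    | zero => exact continuous_const
    | succ n ih =>
      exact intervalIntegral.continuous_primitive
        (fun _ _ => (hA.clm_apply ih).intervalIntegrable _ _) _
  have Wd : ∀ n t, HasDerivAt (W (n + 1)) (A t (W n t)) t := fun n t =>
    intervalIntegral.integral_hasDerivAt_right ((hA.clm_apply (Wc n)).intervalIntegrable _ _)
      ((hA.clm_apply (Wc n)).stronglyMeasurableAtFilter _ _) (hA.clm_apply (Wc n)).continuousAt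
  have Wb : ∀ n t, ‖W n t‖ ≤ ‖w₀‖ * (K * |t - t₀|) ^ n / n.factorial := by
    intro n
    induction n with
    | zero => intro t; simp [W0]
    | succ n ih =>
      intro t
      rw [WS, intervalIntegral.norm_intervalIntegral_eq]
      calc ‖∫ s in uIoc t₀ t, A s (W n s)‖
          ≤ ∫ s in uIoc t₀ t, ‖w₀‖ * K ^ (n + 1) / n.factorial * |s - t₀| ^ n := by
            apply MeasureTheory.norm_integral_le_of_norm_le
              (Continuous.integrableOn_uIoc (by fun_prop))
            refine Eventually.of_forall fun s => ?_
            calc ‖A s (W n s)‖ ≤ K * (‖w₀‖ * (K * |s - t₀|) ^ n / n.factorial) :=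
                  (A s).le_of_opNorm_le_of_le (hK s) (ih s)
              _ = _ := by ring
        _ = ‖w₀‖ * (K * |t - t₀|) ^ (n + 1) / (n + 1).factorial := by
            rw [integral_const_mul, integral_pow_abs_sub_uIoc, Nat.factorial_succ]
            push_cast
            field_simp
            ring
  have hsum : ∀ t, Summable fun n => W n t := fun t => by
    refine .of_norm_bounded (g := fun n => ‖w₀‖ * (K * |t - t₀|) ^ n / n.factorial) ?_
      fun n => Wb n t
    simpa only [mul_div_assoc] using (Real.summable_pow_div_factorial (K * |t - t₀|)).mul_left ‖w₀‖
  refine ⟨fun t => ∑' n, W n t, ?_, fun t => ?_⟩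
  · change ∑' n, W n t₀ = w₀
    refine (tsum_eq_single 0 fun n hn => ?_).trans (W0 t₀)
    obtain ⟨m, rfl⟩ := Nat.exists_eq_succ_of_ne_zero hn
    simp [WS]
  · let R := |t - t₀| + 1
    have hR : 0 < R := by positivity
    have key := hasDerivAt_tsum_of_isPreconnected (𝕜 := ℝ) (g := fun n => W (n + 1))
      (g' := fun n s => A s (W n s)) (u := fun n => K * (‖w₀‖ * (K * R) ^ n / n.factorial))
      (t := Metric.ball t₀ R) (y₀ := t₀) (y := t)
      (by
        simpa only [mul_div_assoc] using
          ((Real.summable_pow_div_factorial (K * R)).mul_left ‖w₀‖).mul_left K)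
      Metric.isOpen_ball (convex_ball _ _).isPreconnected (fun n s _ => Wd n s)
      (fun n s hs => by
        have : |s - t₀| ≤ R := by rw [← Real.dist_eq]; exact (Metric.mem_ball.1 hs).le
        refine (A s).le_of_opNorm_le_of_le (hK s) ((Wb n s).trans ?_)
        gcongr)
      (Metric.mem_ball_self hR) ((summable_nat_add_iff 1).2 (hsum t₀))
      (by rw [Metric.mem_ball, Real.dist_eq]; simp [R])
    rw [← (A t).map_tsum (hsum t)] at key
    have h2 : (fun s => ∑' n, W n s) = fun s => w₀ + ∑' n, W (n + 1) s := by
      funext s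
      rw [(hsum s).tsum_eq_zero_add, W0]
    change HasDerivAt (fun s => ∑' n, W n s) (A t (∑' n, W n t)) t
    rw [h2]
    exact key.const_add w₀

/-- The initial value problem `u'' = p u` with a continuous bounded coefficient `p`, written as a
first order system for `(u, v) = (u, u')`. -/
theorem exists_second_order_solution (p : ℝ → ℂ) (hp : Continuous p) (M : ℝ)
    (hM : ∀ t, ‖p t‖ ≤ M) (t₀ : ℝ) (A B : ℂ) :
    ∃ u v : ℝ → ℂ, u t₀ = A ∧ v t₀ = B ∧ (∀ t, HasDerivAt u (v t) t) ∧
      ∀ t, HasDerivAt v (p t * u t) t := by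
  let X : (ℂ × ℂ) →L[ℝ] (ℂ × ℂ) :=
    (ContinuousLinearMap.inl ℝ ℂ ℂ).comp (ContinuousLinearMap.snd ℝ ℂ ℂ)
  let Y : (ℂ × ℂ) →L[ℂ] (ℂ × ℂ) :=
    (ContinuousLinearMap.inr ℂ ℂ ℂ).comp (ContinuousLinearMap.fst ℂ ℂ ℂ)
  let T : ℝ → (ℂ × ℂ) →L[ℝ] (ℂ × ℂ) := fun t => X + (p t • Y).restrictScalars ℝ
  have hT : Continuous T := by
    have : Continuous fun t => (p t • Y).restrictScalars ℝ :=
      (ContinuousLinearMap.restrictScalarsL ℂ (ℂ × ℂ) (ℂ × ℂ) ℝ ℝ).continuous.comp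
        (hp.smul continuous_const)
    exact continuous_const.add this
  have hTb : ∀ t, ‖T t‖ ≤ ‖X‖ + M * ‖Y‖ := fun t => by
    refine (norm_add_le _ _).trans ?_
    rw [ContinuousLinearMap.norm_restrictScalars, norm_smul]
    gcongr
    exact hM t
  obtain ⟨w, hw₀, hw⟩ := exists_linear_ode_solution T hT _ hTb t₀ (A, B)
  refine ⟨fun t => (w t).1, fun t => (w t).2, by simp [hw₀], by simp [hw₀], fun t => ?_,
    fun t => ?_⟩
  · have h := (ContinuousLinearMap.fst ℝ ℂ ℂ).hasFDerivAt.comp_hasDerivAt t (hw t)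
    simp [T, X, Y] at h
    exact h
  · have h := (ContinuousLinearMap.snd ℝ ℂ ℂ).hasFDerivAt.comp_hasDerivAt t (hw t)
    simp [T, X, Y] at h
    exact h

/-- Existence for the initial value problem: `q` is continuous on `(c, d)` with finite limits at
the end points, and the Cauchy data are given at a point `t₀` of `[c, d]`. -/
theorem exists_isSolution {q : ℝ → ℝ} {c d : ℝ} (hcd : c < d) (hq : ContinuousOn q (Ioo c d))
    (hc : ∃ l, Tendsto q (𝓝[>] c) (𝓝 l)) (hd : ∃ l, Tendsto q (𝓝[<] d) (𝓝 l))
    (lam : ℂ) {t₀ : ℝ} (ht₀ : t₀ ∈ Icc c d) (A B : ℂ) :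
    ∃ u : ℝ → ℂ, IsSolution q lam c d u ∧ u t₀ = A ∧ derivWithin u (Icc c d) t₀ = B := by
  obtain ⟨lc, hlc⟩ := hc
  obtain ⟨ld, hld⟩ := hd
  have hQ : ContinuousOn (extendFrom (Ioo c d) q) (Icc c d) :=
    continuousOn_Icc_extendFrom_Ioo hq hlc hld
  let p : ℝ → ℂ := fun x => ((extendFrom (Ioo c d) q (projIcc c d hcd.le x) : ℝ) : ℂ) - lam
  have hpc : Continuous p :=
    (Complex.continuous_ofReal.comp (hQ.comp_continuous
      (continuous_subtype_val.comp continuous_projIcc)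
      fun x => (projIcc c d hcd.le x).2)).sub continuous_const
  have hpq : ∀ x ∈ Ioo c d, p x = (q x : ℂ) - lam := fun x hx => by
    simp only [p, projIcc_of_mem hcd.le (Ioo_subset_Icc_self hx)]
    rw [extendFrom_extends hq x hx]
  obtain ⟨M, hM⟩ : ∃ M, ∀ x, ‖p x‖ ≤ M := by
    obtain ⟨M, hM⟩ := isCompact_Icc.exists_bound_of_continuousOn hQ
    refine ⟨M + ‖lam‖, fun x => (norm_sub_le _ _).trans ?_⟩
    rw [Complex.norm_real]
    gcongr
    exact hM _ (projIcc c d hcd.le x).2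
  obtain ⟨u, v, hu, hv, h1, h2⟩ := exists_second_order_solution p hpc M hM t₀ A B
  have hder : deriv u = v := funext fun t => (h1 t).deriv
  refine ⟨u, ⟨?_, fun x hx => ⟨_, hder ▸ h2 x, ?_⟩⟩, hu, ?_⟩
  · refine (contDiff_one_iff_deriv.2 ⟨fun t => (h1 t).differentiableAt, ?_⟩).contDiffOn
    rw [hder]
    exact continuous_iff_continuousAt.2 fun t => (h2 t).continuousAt
  · rw [hpq x hx]; ring
  · rw [((h1 t₀).hasDerivWithinAt).derivWithin (uniqueDiffOn_Icc hcd t₀ ht₀), hv]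

/-- The data of the boundary value problem with transmission conditions, with the standing
assumptions on them. The discontinuities are at `θ - ε` and `θ + ε` with `θ = (a + b) / 2`. -/
structure Problem where
  (a b ε : ℝ)
  q : ℝ → ℝ
  (β₁ β₂ α₁ α₂ α₁' α₂' δ γ : ℝ)
  ε_pos : 0 < ε
  ε_lt : ε < (b - a) / 2
  q_contL : ContinuousOn q (Ico a ((a + b) / 2 - ε))
  q_contM : ContinuousOn q (Ioo ((a + b) / 2 - ε) ((a + b) / 2 + ε))
  q_contR : ContinuousOn q (Ioc ((a + b) / 2 + ε) b)
  q_limL_left : ∃ l, Tendsto q (𝓝[<] ((a + b) / 2 - ε)) (𝓝 l)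
  q_limL_right : ∃ l, Tendsto q (𝓝[>] ((a + b) / 2 - ε)) (𝓝 l)
  q_limR_left : ∃ l, Tendsto q (𝓝[<] ((a + b) / 2 + ε)) (𝓝 l)
  q_limR_right : ∃ l, Tendsto q (𝓝[>] ((a + b) / 2 + ε)) (𝓝 l)
  β_ne : |β₁| + |β₂| ≠ 0
  δ_ne : δ ≠ 0
  γ_ne : γ ≠ 0
  ρ_pos : 0 < α₁' * α₂ - α₁ * α₂'

namespace Problem

noncomputable section

variable (P : Problem)

/-- The left discontinuity point `θ - ε`. -/
def θm : ℝ := (P.a + P.b) / 2 - P.ε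

/-- The right discontinuity point `θ + ε`. -/
def θp : ℝ := (P.a + P.b) / 2 + P.ε

theorem a_lt : P.a < P.θm := by
  have := P.ε_lt
  unfold θm
  linarith

theorem θm_lt : P.θm < P.θp := by
  have := P.ε_pos
  unfold θm θp
  linarith

theorem lt_b : P.θp < P.b := by
  have := P.ε_lt
  unfold θp
  linarith

theorem existsL (lam : ℂ) {t₀ : ℝ} (ht₀ : t₀ ∈ Icc P.a P.θm) (A B : ℂ) :
    ∃ u : ℝ → ℂ, IsSolution P.q lam P.a P.θm u ∧ u t₀ = A ∧
      derivWithin u (Icc P.a P.θm) t₀ = B :=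
  exists_isSolution P.a_lt (P.q_contL.mono Ioo_subset_Ico_self)
    ⟨_, ((P.q_contL P.a ⟨le_rfl, P.a_lt⟩).mono Ioo_subset_Ico_self).tendsto.mono_left
      (nhdsWithin_Ioo_eq_nhdsGT P.a_lt).ge⟩ P.q_limL_left lam ht₀ A B

theorem existsM (lam : ℂ) {t₀ : ℝ} (ht₀ : t₀ ∈ Icc P.θm P.θp) (A B : ℂ) :
    ∃ u : ℝ → ℂ, IsSolution P.q lam P.θm P.θp u ∧ u t₀ = A ∧
      derivWithin u (Icc P.θm P.θp) t₀ = B :=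
  exists_isSolution P.θm_lt P.q_contM P.q_limL_right P.q_limR_left lam ht₀ A B

theorem existsR (lam : ℂ) {t₀ : ℝ} (ht₀ : t₀ ∈ Icc P.θp P.b) (A B : ℂ) :
    ∃ u : ℝ → ℂ, IsSolution P.q lam P.θp P.b u ∧ u t₀ = A ∧
      derivWithin u (Icc P.θp P.b) t₀ = B :=
  exists_isSolution P.lt_b (P.q_contR.mono Ioo_subset_Ioc_self) P.q_limR_right
    ⟨_, ((P.q_contR P.b ⟨P.lt_b, le_rfl⟩).mono Ioo_subset_Ioc_self).tendsto.mono_left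
      (nhdsWithin_Ioo_eq_nhdsLT P.lt_b).ge⟩ lam ht₀ A B

/-- One-sided derivative on the left closed subinterval `[a, θ - ε]`. -/
def DL (u : ℝ → ℂ) (x : ℝ) : ℂ := derivWithin u (Icc P.a P.θm) x

/-- One-sided derivative on the middle closed subinterval `[θ - ε, θ + ε]`. -/
def DM (u : ℝ → ℂ) (x : ℝ) : ℂ := derivWithin u (Icc P.θm P.θp) x

/-- One-sided derivative on the right closed subinterval `[θ + ε, b]`. -/
def DR (u : ℝ → ℂ) (x : ℝ) : ℂ := derivWithin u (Icc P.θp P.b) x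

/-- `lam` is an eigenvalue: there is a nontrivial solution of the equation on the three
subintervals (with restrictions `uL`, `uM`, `uR`, extended by their limits to the end points)
which satisfies both boundary conditions and the four transmission conditions. -/
def IsEigenvalue (lam : ℂ) : Prop :=
  ∃ uL uM uR : ℝ → ℂ,
    IsSolution P.q lam P.a P.θm uL ∧ IsSolution P.q lam P.θm P.θp uM ∧
    IsSolution P.q lam P.θp P.b uR ∧
    P.β₁ * uL P.a + P.β₂ * P.DL uL P.a = 0 ∧
    lam * (P.α₁' * uR P.b - P.α₂' * P.DR uR P.b) + (P.α₁ * uR P.b - P.α₂ * P.DR uR P.b) = 0 ∧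
    uL P.θm - P.δ * uM P.θm = 0 ∧
    P.DL uL P.θm - P.δ * P.DM uM P.θm = 0 ∧
    P.δ * uM P.θp - P.γ * uR P.θp = 0 ∧
    P.δ * P.DM uM P.θp - P.γ * P.DR uR P.θp = 0 ∧
    ¬((∀ x ∈ Icc P.a P.θm, uL x = 0) ∧ (∀ x ∈ Icc P.θm P.θp, uM x = 0) ∧
      ∀ x ∈ Icc P.θp P.b, uR x = 0)

/-- The solution `φ` on `[a, θ - ε]`: `φ(a) = β₂`, `φ'(a) = -β₁`. (The initial value problem
determines it on that interval; its values elsewhere are never used. Likewise below.) -/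
def phiL (lam : ℂ) : ℝ → ℂ :=
  (P.existsL lam (left_mem_Icc.2 P.a_lt.le) P.β₂ (-P.β₁)).choose

/-- The solution `φ` on `[θ - ε, θ + ε]`. -/
def phiM (lam : ℂ) : ℝ → ℂ :=
  (P.existsM lam (left_mem_Icc.2 P.θm_lt.le) ((P.δ : ℂ)⁻¹ * P.phiL lam P.θm)
    ((P.δ : ℂ)⁻¹ * P.DL (P.phiL lam) P.θm)).choose

/-- The solution `φ` on `[θ + ε, b]`. -/
def phiR (lam : ℂ) : ℝ → ℂ :=
  (P.existsR lam (left_mem_Icc.2 P.lt_b.le) (P.δ * (P.γ : ℂ)⁻¹ * P.phiM lam P.θp)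
    (P.δ * (P.γ : ℂ)⁻¹ * P.DM (P.phiM lam) P.θp)).choose

/-- The solution `χ` on `[θ + ε, b]`: `χ(b) = lam α₂' + α₂`, `χ'(b) = lam α₁' + α₁`. -/
def chiR (lam : ℂ) : ℝ → ℂ :=
  (P.existsR lam (right_mem_Icc.2 P.lt_b.le) (lam * P.α₂' + P.α₂) (lam * P.α₁' + P.α₁)).choose

/-- The solution `χ` on `[θ - ε, θ + ε]`. -/
def chiM (lam : ℂ) : ℝ → ℂ :=
  (P.existsM lam (right_mem_Icc.2 P.θm_lt.le) (P.γ * (P.δ : ℂ)⁻¹ * P.chiR lam P.θp)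
    (P.γ * (P.δ : ℂ)⁻¹ * P.DR (P.chiR lam) P.θp)).choose

/-- The solution `χ` on `[a, θ - ε]`. -/
def chiL (lam : ℂ) : ℝ → ℂ :=
  (P.existsL lam (right_mem_Icc.2 P.a_lt.le) (P.δ * P.chiM lam P.θm)
    (P.δ * P.DM (P.chiM lam) P.θm)).choose

/-- The Wronskian `φ χ' - φ' χ` on `[a, θ - ε]`. It does not depend on the point, and is taken
at `x = a`. -/
def omega (lam : ℂ) : ℂ :=
  P.phiL lam P.a * P.DL (P.chiL lam) P.a - P.DL (P.phiL lam) P.a * P.chiL lam P.a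

/-- The transform of `g` with kernel `φ` and weights `1`, `δ²`, `γ²`. -/
def F (g : ℝ → ℂ) (lam : ℂ) : ℂ :=
  (∫ x in P.a..P.θm, g x * P.phiL lam x) +
    (P.δ : ℂ) ^ 2 * (∫ x in P.θm..P.θp, g x * P.phiM lam x) +
    (P.γ : ℂ) ^ 2 * ∫ x in P.θp..P.b, g x * P.phiR lam x

/-- The sampling function `ω(lam) / ((lam - μ) ω'(μ))` at a zero `μ` of `ω`, with its removable
singularity at `lam = μ` removed. -/
def sampling (μ lam : ℂ) : ℂ :=
  if lam = μ then 1 else P.omega lam / ((lam - μ) * deriv P.omega μ)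

end

end Problem

end SL

/-! Weighting the three pieces of a function by 1, δ, γ turns the transmission conditions into
continuity of the function and of its derivative. The problem becomes one equation on [a, b] whose
potential jumps at two points, and F(λ) becomes ∫ (weighted g) φ_λ, the squares δ², γ² coming from
one weight on each factor.

Put R(λ) = α₁'φ(b) - α₂'φ'(b). Since λ enters the boundary condition at b, the right space is L²(a,
b) ⊕ ℂ with the vectors Φ_λ = (φ_λ, R(λ)/√ρ). Lagrange's identity and ρ > 0 give a
Christoffel-Darboux formula (`isKernelFamily`): (z - w̄)⟨Φ_w, Φ_z⟩ is a constant times ω(z) conj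
R(w) - conj ω(w) R(z).

This formula carries nearly everything. On the diagonal it makes the zeros of ω real; at a zero t it
gives ⟨Φ_t, Φ_z⟩ = conj r(t) ω(z)/(z - t), with r the multiple of R there, hence simple zeros,
orthogonality of the Φ_t, and sampling functions that are normalized kernels. It also bounds |Im z|
‖Φ_z‖ by a multiple of |ω(z)|. If x is orthogonal to every Φ_t, then ⟨x, Φ_z⟩/ω(z) is entire and
O(1/|Im z|), hence zero (`inner_eq_zero_of_forall`): the Φ_t span all the Φ_z. The sampling series
is then the orthogonal expansion of the vector representing F, projected to that span, and norm
convergence gives uniform convergence on compact sets (`sampling_series`).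

The differential equation supplies the rest: holomorphy of Φ by a Neumann series
(`differentiable_of_volterra`), the growth of φ by an energy estimate (`exists_norm_phi_le`),
infinitely many zeros because the Φ_n are linearly independent, and a lower bound for the zeros by
growth of φ at very negative λ (`exists_lower_bound`). -/

namespace SL

open scoped ComplexConjugate

/-! ### A Liouville-type theorem and the enumeration of discrete sets of reals. -/

/-- An entire function which is `O(1 / |Im z|)` vanishes identically. -/
theorem eq_zero_of_norm_mul_abs_im_le {f : ℂ → ℂ} (hf : Differentiable ℂ f) {C : ℝ}
    (hC : ∀ z, ‖f z‖ * |z.im| ≤ C) (w : ℂ) : f w = 0 := by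
  have key : ∀ R : ℝ, 2 * ‖w‖ + 1 < R → ‖f w‖ * (R ^ 2 - ‖w‖ ^ 2) ≤ 2 * R * C := by
    intro R hR
    have hw := norm_nonneg w
    have hR0 : 0 < R := by linarith
    -- On |z| = R one has z² - R² = z(z - z̄), of modulus 2R|Im z|. This factor absorbs the blow-up
    -- of the bound near the real axis, and the maximum principle applies; it gains R² at w against
    -- a loss of only 2R.
    have hg : Differentiable ℂ fun z : ℂ => (z ^ 2 - (R : ℂ) ^ 2) * f z := by fun_prop
    have h := Complex.norm_le_of_forall_mem_frontier_norm_le (U := Metric.ball (0 : ℂ) R)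
      Metric.isBounded_ball hg.diffContOnCl (C := 2 * R * C) (fun z hz => by
        rw [frontier_ball _ hR0.ne', mem_sphere_zero_iff_norm] at hz
        have h1 : z ^ 2 - (R : ℂ) ^ 2 = z * (2 * z.im * Complex.I) := by
          have := Complex.sub_conj z
          push_cast at this
          rw [← hz, ← Complex.mul_conj', ← this]
          ring
        have h2 : ‖z ^ 2 - (R : ℂ) ^ 2‖ = 2 * R * |z.im| := by
          rw [h1]
          simp [hz]
          ring
        calc ‖(z ^ 2 - (R : ℂ) ^ 2) * f z‖ = 2 * R * (‖f z‖ * |z.im|) := by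
              rw [norm_mul, h2]; ring
          _ ≤ 2 * R * C := by gcongr; exact hC z)
      (z := w) (subset_closure (by rw [mem_ball_zero_iff]; linarith))
    have h3 : R ^ 2 - ‖w‖ ^ 2 ≤ ‖w ^ 2 - (R : ℂ) ^ 2‖ := by
      have := norm_sub_norm_le ((R : ℂ) ^ 2) (w ^ 2)
      rw [norm_sub_rev] at this
      simpa [abs_of_pos hR0] using this
    calc ‖f w‖ * (R ^ 2 - ‖w‖ ^ 2) ≤ ‖f w‖ * ‖w ^ 2 - (R : ℂ) ^ 2‖ := by gcongr
      _ = ‖(w ^ 2 - (R : ℂ) ^ 2) * f w‖ := by rw [norm_mul, mul_comm]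
      _ ≤ _ := h
  by_contra hne
  have hpos : 0 < ‖f w‖ := norm_pos_iff.2 hne
  have hC0 : 0 ≤ C := (by positivity : 0 ≤ ‖f w‖ * |w.im|).trans (hC w)
  have hw := norm_nonneg w
  have h0 : 0 ≤ C / ‖f w‖ := by positivity
  -- With this R, ‖w‖ < R/2 and C/‖f w‖ < R/4, so R² - ‖w‖² exceeds 3R²/4 while the right side of
  -- `key`, divided by ‖f w‖, is below R²/2.
  have h := key (2 * ‖w‖ + 2 + 4 * (C / ‖f w‖)) (by linarith)
  have hCe : C = C / ‖f w‖ * ‖f w‖ := by field_simp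
  set D := C / ‖f w‖
  set R := 2 * ‖w‖ + 2 + 4 * D with hR
  rw [hCe] at h
  have h' : R ^ 2 - ‖w‖ ^ 2 ≤ 2 * R * D := by
    by_contra hlt
    push Not at hlt
    nlinarith
  nlinarith

/-- A set of reals which is infinite, bounded below and locally finite is the range of a strictly
increasing sequence. -/
theorem exists_strictMono_range_eq {Z : Set ℝ} (hinf : Z.Infinite) (hbdd : BddBelow Z)
    (hfin : ∀ x y, (Z ∩ Icc x y).Finite) : ∃ s : ℕ → ℝ, StrictMono s ∧ range s = Z := by
  have hIcc : ∀ x y : Z, (Icc x y).Finite := fun x y => by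
    refine Set.Finite.of_finite_image (f := Subtype.val) ((hfin x y).subset ?_)
      Subtype.val_injective.injOn
    rintro _ ⟨z, hz, rfl⟩
    exact ⟨z.2, hz.1, hz.2⟩
  obtain ⟨m, hm⟩ := hbdd
  obtain ⟨z₀, hz₀⟩ := hinf.nonempty
  obtain ⟨b, ⟨hbZ, hbz⟩, hb⟩ := (hfin m z₀).exists_minimalFor id _ ⟨z₀, hz₀, hm hz₀, le_rfl⟩
  have hleast : ∀ z ∈ Z, b ≤ z := fun z hz => by
    rcases le_total z z₀ with h | h
    · by_contra hlt
      exact hlt (hb ⟨hz, hm hz, h⟩ (not_le.1 hlt).le)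
    · exact hbz.2.trans h
  -- A locally finite linear order with a least and no greatest element is order isomorphic to ℕ.
  let _ : LocallyFiniteOrder Z := LocallyFiniteOrder.ofFiniteIcc hIcc
  let _ : OrderBot Z := { bot := ⟨b, hbZ⟩, bot_le := fun z => hleast z z.2 }
  have _ : NoMaxOrder Z := ⟨fun x => by
    by_contra! hx
    refine hinf ((hfin m x).subset fun z hz => ⟨hz, hm hz, hx ⟨z, hz⟩⟩)⟩
  let _ : SuccOrder Z := LinearLocallyFiniteOrder.succOrder Z
  let _ : PredOrder Z := LinearLocallyFiniteOrder.predOrder Z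
  let e : Z ≃o ℕ := orderIsoNatOfLinearSuccPredArch
  refine ⟨fun n => (e.symm n : ℝ), fun i j hij => e.symm.strictMono hij, ?_⟩
  ext z
  constructor
  · rintro ⟨n, rfl⟩
    exact (e.symm n).2
  · exact fun hz => ⟨e ⟨z, hz⟩, by simp⟩

/-! ### The abstract sampling theorem for kernel families. -/

/-- A family of vectors `Φ z` of a Hilbert space depending holomorphically on `z ∈ ℂ`, whose
inner products are given by a formula of Christoffel-Darboux type in terms of two functions
`ω` and `r`, the second of which is controlled by the norm of `Φ`. -/
structure IsKernelFamily {H : Type*} [NormedAddCommGroup H] [InnerProductSpace ℂ H]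
    (Φ : ℂ → H) (ω r : ℂ → ℂ) (C : ℝ) : Prop where
  differentiable : Differentiable ℂ Φ
  differentiable_omega : Differentiable ℂ ω
  ne_zero : ∀ z, Φ z ≠ 0
  kernel : ∀ z w, (z - conj w) * inner ℂ (Φ w) (Φ z) = conj (r w) * ω z - conj (ω w) * r z
  norm_le : ∀ z, ‖r z‖ ≤ C * ‖Φ z‖

namespace IsKernelFamily

variable {H : Type*} [NormedAddCommGroup H] [InnerProductSpace ℂ H]
  {Φ : ℂ → H} {ω r : ℂ → ℂ} {C : ℝ}

theorem im_eq_zero (h : IsKernelFamily Φ ω r C) {z : ℂ} (hz : ω z = 0) : z.im = 0 := by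
  have h1 := h.kernel z z
  rw [hz, map_zero, mul_zero, zero_mul, sub_zero, mul_eq_zero] at h1
  rcases h1 with h1 | h1
  · exact Complex.conj_eq_iff_im.1 (sub_eq_zero.1 h1).symm
  · exact absurd (inner_self_eq_zero.1 h1) (h.ne_zero z)

theorem mul_inner (h : IsKernelFamily Φ ω r C) {t : ℂ} (ht : ω t = 0) (z : ℂ) :
    (z - t) * inner ℂ (Φ t) (Φ z) = conj (r t) * ω z := by
  have h1 := h.kernel z t
  rwa [ht, map_zero, zero_mul, sub_zero, Complex.conj_eq_iff_im.2 (h.im_eq_zero ht)] at h1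

/-- The derivative of `mul_inner` at z = t. As the left side is positive, it forces the zero to be
simple and `r t` to be nonzero. -/
theorem norm_sq_eq (h : IsKernelFamily Φ ω r C) {t : ℂ} (ht : ω t = 0) :
    inner ℂ (Φ t) (Φ t) = conj (r t) * deriv ω t := by
  have h1 : HasDerivAt (fun z => (z - t) * inner ℂ (Φ t) (Φ z)) (inner ℂ (Φ t) (Φ t)) t := by
    have h2 : HasDerivAt (fun z => inner ℂ (Φ t) (Φ z)) _ t :=
      ((innerSL ℂ (Φ t)).hasFDerivAt.comp_hasDerivAt t (h.differentiable t).hasDerivAt)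
    refine (((hasDerivAt_id t).sub_const t).mul h2).congr_deriv ?_
    simp
  have h3 : HasDerivAt (fun z => (z - t) * inner ℂ (Φ t) (Φ z)) (conj (r t) * deriv ω t) t := by
    simp only [h.mul_inner ht]
    exact (h.differentiable_omega t).hasDerivAt.const_mul _
  exact h1.unique h3

theorem ne_zero_of_omega_eq_zero (h : IsKernelFamily Φ ω r C) {t : ℂ} (ht : ω t = 0) :
    r t ≠ 0 ∧ deriv ω t ≠ 0 := by
  have h1 := h.norm_sq_eq ht
  constructor <;> intro h0 <;> rw [h0] at h1 <;>
    exact h.ne_zero t ((inner_self_eq_zero (𝕜 := ℂ)).1 (by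
      simpa only [map_zero, zero_mul, mul_zero] using h1))

/-- The sampling functions are the normalized kernels at the zeros of `ω`. -/
theorem inner_div_eq (h : IsKernelFamily Φ ω r C) {t : ℂ} (ht : ω t = 0) (z : ℂ) :
    inner ℂ (Φ t) (Φ z) / inner ℂ (Φ t) (Φ t) =
      if z = t then 1 else ω z / ((z - t) * deriv ω t) := by
  have h0 : inner ℂ (Φ t) (Φ t) ≠ 0 := fun h0 => h.ne_zero t (inner_self_eq_zero.1 h0)
  split_ifs with hz
  · rw [hz, div_self h0]
  · have h1 := h.mul_inner ht z
    have h2 := h.norm_sq_eq ht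
    have h3 := (h.ne_zero_of_omega_eq_zero ht).2
    have h4 : z - t ≠ 0 := sub_ne_zero.2 hz
    rw [div_eq_div_iff h0 (mul_ne_zero h4 h3), h2]
    linear_combination deriv ω t * h1

theorem inner_eq_zero (h : IsKernelFamily Φ ω r C) {s t : ℂ} (hs : ω s = 0) (ht : ω t = 0)
    (hst : s ≠ t) : inner ℂ (Φ s) (Φ t) = 0 := by
  have h1 := h.mul_inner hs t
  rw [ht, mul_zero] at h1
  exact (mul_eq_zero.1 h1).resolve_left (sub_ne_zero.2 hst.symm)

/-- On the diagonal the kernel formula reads 2|Im z| ‖Φ z‖² ≤ 2 ‖r z‖ ‖ω z‖; the bound on `r`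
cancels one factor ‖Φ z‖. -/
theorem abs_im_mul_norm_le (h : IsKernelFamily Φ ω r C) (z : ℂ) :
    |z.im| * ‖Φ z‖ ≤ C * ‖ω z‖ := by
  have hpos : 0 < ‖Φ z‖ := norm_pos_iff.2 (h.ne_zero z)
  have h1 := congrArg norm (h.kernel z z)
  rw [norm_mul, inner_self_eq_norm_sq_to_K, Complex.sub_conj] at h1
  have h2 : ‖conj (r z) * ω z - conj (ω z) * r z‖ ≤ 2 * (‖r z‖ * ‖ω z‖) := by
    refine (norm_sub_le _ _).trans (le_of_eq ?_)
    simp only [norm_mul, RCLike.norm_conj]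
    ring
  rw [← h1] at h2
  simp only [norm_mul, Complex.norm_real, norm_pow, Complex.norm_I, mul_one, Real.norm_eq_abs,
    Complex.coe_algebraMap, abs_norm, abs_two] at h2
  have h3 : ‖r z‖ * ‖ω z‖ ≤ C * ‖Φ z‖ * ‖ω z‖ := by gcongr; exact h.norm_le z
  have h4 : (|z.im| * ‖Φ z‖) * ‖Φ z‖ ≤ (C * ‖ω z‖) * ‖Φ z‖ := by nlinarith
  exact le_of_mul_le_mul_right h4 hpos

/-- A vector orthogonal to `Φ t` for all zeros `t` of `ω` is orthogonal to all `Φ z`. -/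
theorem inner_eq_zero_of_forall (h : IsKernelFamily Φ ω r C) {x : H}
    (hx : ∀ t, ω t = 0 → inner ℂ x (Φ t) = 0) (z : ℂ) : inner ℂ x (Φ z) = 0 := by
  let D : ℂ → ℂ := fun z => inner ℂ x (Φ z)
  have hD : Differentiable ℂ D := fun z =>
    (((innerSL ℂ x).hasFDerivAt.comp_hasDerivAt z
      (h.differentiable z).hasDerivAt).differentiableAt)
  have hω := h.differentiable_omega
  have hC : ∀ z, ‖D z‖ * |z.im| ≤ ‖x‖ * C * ‖ω z‖ := fun z => by
    calc ‖D z‖ * |z.im| ≤ ‖x‖ * ‖Φ z‖ * |z.im| := by gcongr; exact norm_inner_le_norm _ _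
      _ = ‖x‖ * (|z.im| * ‖Φ z‖) := by ring
      _ ≤ ‖x‖ * (C * ‖ω z‖) :=
        mul_le_mul_of_nonneg_left (h.abs_im_mul_norm_le z) (norm_nonneg x)
      _ = _ := by ring
  have hdslope : ∀ {f : ℂ → ℂ}, Differentiable ℂ f → ∀ t, Differentiable ℂ (dslope f t) :=
    fun hf t => by
      rw [← differentiableOn_univ] at hf ⊢
      exact (Complex.differentiableOn_dslope univ_mem).2 hf
  -- The quotient D/ω with its singularities removed: D vanishes at the zeros of ω, which are
  -- simple. Near a zero it is the quotient of the two `dslope`s.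
  let Q : ℂ → ℂ := fun z => if ω z = 0 then deriv D z / deriv ω z else D z / ω z
  have hQ : Differentiable ℂ Q := by
    intro t
    by_cases ht : ω t = 0
    · have hne : dslope ω t t ≠ 0 := by
        rw [dslope_same]; exact (h.ne_zero_of_omega_eq_zero ht).2
      have hev : ∀ᶠ z in 𝓝 t, dslope ω t z ≠ 0 :=
        (hdslope hω t t).continuousAt.eventually_ne hne
      refine (((hdslope hD t t).div (hdslope hω t t) hne)).congr_of_eventuallyEq ?_
      filter_upwards [hev] with z hz
      by_cases hzt : z = t
      · simp [Q, hzt, ht, dslope_same]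
      · have hzt' := sub_ne_zero.2 hzt
        rw [dslope_of_ne _ hzt, slope_def_field, ht, sub_zero] at hz
        have hz0 : ω z ≠ 0 := fun h0 => hz (by rw [h0, zero_div])
        have hDt : D t = 0 := hx t ht
        simp only [Q, hz0, if_false, Pi.div_apply]
        rw [dslope_of_ne _ hzt, dslope_of_ne _ hzt, slope_def_field, slope_def_field, ht, hDt]
        field_simp
        simp [mul_comm]
    · refine ((hD t).div (hω t) ht).congr_of_eventuallyEq ?_
      filter_upwards [(hω t).continuousAt.eventually_ne ht] with z hz
      simp [Q, hz]
  have hQb : ∀ z, ‖Q z‖ * |z.im| ≤ ‖x‖ * |C| := fun z => by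
    by_cases hz : ω z = 0
    · rw [h.im_eq_zero hz]
      simp; positivity
    · simp only [Q, hz, if_false, norm_div]
      have h1 : 0 < ‖ω z‖ := norm_pos_iff.2 hz
      rw [div_mul_eq_mul_div, div_le_iff₀ h1]
      refine (hC z).trans ?_
      gcongr
      exact le_abs_self C
  have hQ0 := eq_zero_of_norm_mul_abs_im_le hQ hQb z
  by_cases hz : ω z = 0
  · exact hx z hz
  · simp only [Q, hz, if_false, div_eq_zero_iff, or_false] at hQ0
    exact hQ0

theorem mem_closure_span [CompleteSpace H] (h : IsKernelFamily Φ ω r C) (z : ℂ) :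
    Φ z ∈ (Submodule.span ℂ (Φ '' {t | ω t = 0})).topologicalClosure := by
  rw [← Submodule.orthogonal_orthogonal_eq_closure, Submodule.mem_orthogonal]
  intro x hx
  refine h.inner_eq_zero_of_forall (fun t ht => ?_) z
  exact Submodule.mem_orthogonal' _ _ |>.1 hx _ (Submodule.subset_span ⟨t, ht, rfl⟩)

/-- Finitely many zeros would give a finite-dimensional, hence closed, span containing every Φ z. -/
theorem infinite_zeros [CompleteSpace H] (h : IsKernelFamily Φ ω r C)
    (hli : LinearIndependent ℂ fun n : ℕ => Φ n) : {t | ω t = 0}.Infinite := by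
  intro hfin
  have : FiniteDimensional ℂ (Submodule.span ℂ (Φ '' {t | ω t = 0})) :=
    FiniteDimensional.span_of_finite ℂ (hfin.image _)
  have hmem : ∀ n : ℕ, Φ n ∈ Submodule.span ℂ (Φ '' {t | ω t = 0}) := fun n => by
    have := h.mem_closure_span n
    rwa [Submodule.closed_of_finiteDimensional _ |>.submodule_topologicalClosure_eq] at this
  have hli' : LinearIndependent ℂ fun n : ℕ =>
      (⟨Φ n, hmem n⟩ : Submodule.span ℂ (Φ '' {t | ω t = 0})) :=
    LinearIndependent.of_comp (Submodule.subtype _) hli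
  have := hli'.finite
  exact not_finite ℕ

/-- Zeros accumulating at t would make t a zero at which the derivative of ω vanishes too, against
simplicity. -/
theorem finite_zeros_inter (h : IsKernelFamily Φ ω r C) (x y : ℝ) :
    ({t : ℝ | ω t = 0} ∩ Icc x y).Finite := by
  by_contra hinf
  obtain ⟨t, -, ht⟩ := Set.Infinite.exists_accPt_of_subset_isCompact hinf isCompact_Icc
    inter_subset_right
  have hfr : ∃ᶠ s : ℝ in 𝓝[≠] t, ω s = 0 :=
    (accPt_iff_frequently_nhdsNE.1 ht).mono fun s hs => hs.1
  have hcont : Continuous fun s : ℝ => ω s :=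
    h.differentiable_omega.continuous.comp Complex.continuous_ofReal
  have ht0 : ω t = 0 := by
    by_contra hne
    exact (hfr.filter_mono nhdsWithin_le_nhds) (hcont.continuousAt.eventually_ne hne)
  have hd : HasDerivAt (fun s : ℝ => ω s) (deriv ω t) t :=
    (h.differentiable_omega t).hasDerivAt.comp_ofReal
  exact hfr (hd.eventually_ne (h.ne_zero_of_omega_eq_zero ht0).2)

/-- The expansion of the projection of `x` to the closed span of the kernels along the kernels at
the zeros of `ω`. -/
theorem exists_hasSum [CompleteSpace H] (h : IsKernelFamily Φ ω r C) {s : ℕ → ℝ}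
    (hs : StrictMono s) (hZ : {t | ω t = 0} = range fun n => (s n : ℂ)) (x : H) :
    ∃ y, (∀ z, inner ℂ y (Φ z) = inner ℂ x (Φ z)) ∧
      HasSum (fun n => (inner ℂ (Φ (s n)) x / inner ℂ (Φ (s n)) (Φ (s n))) • Φ (s n)) y := by
  have hsz : ∀ n, ω (s n) = 0 := fun n => hZ.ge ⟨n, rfl⟩
  have horth : Pairwise fun i j => inner ℂ (Φ (s i)) (Φ (s j)) = 0 := fun i j hij =>
    h.inner_eq_zero (hsz i) (hsz j) fun he => hij (hs.injective (Complex.ofReal_injective he))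
  let e : ℕ → H := fun n => ((‖Φ (s n)‖⁻¹ : ℝ) : ℂ) • Φ (s n)
  have hnorm : ∀ n, ‖Φ (s n)‖ ≠ 0 := fun n => norm_ne_zero_iff.2 (h.ne_zero _)
  have he : Orthonormal ℂ e := by
    refine ⟨fun n => ?_, fun i j hij => ?_⟩
    · simp [e, norm_smul, hnorm n]
    · simp only [e, inner_smul_left, inner_smul_right, horth hij, mul_zero]
  have hterm : ∀ n, (inner ℂ (Φ (s n)) x / inner ℂ (Φ (s n)) (Φ (s n))) • Φ (s n) =
      inner ℂ (e n) x • e n := fun n => by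
    have := hnorm n
    simp only [e, inner_smul_left, smul_smul, inner_self_eq_norm_sq_to_K, Complex.conj_ofReal,
      Complex.coe_algebraMap]
    congr 1
    push_cast
    field_simp
  have hsum : Summable fun n => inner ℂ (e n) x • e n := by
    have h1 := (he.orthogonalFamily.summable_iff_norm_sq_summable
      (fun n => inner ℂ (e n) x)).2 (he.inner_products_summable x)
    simpa using h1
  -- The sum y need not be x. But y - x is orthogonal to every Φ at a zero of ω, hence to every Φ z,
  -- and only these inner products matter.
  refine ⟨_, fun z => ?_, by simpa only [hterm] using hsum.hasSum⟩
  rw [← sub_eq_zero, ← inner_sub_left]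
  refine h.inner_eq_zero_of_forall (fun t ht => ?_) z
  obtain ⟨n, rfl⟩ := hZ.le ht
  have h1 : inner ℂ (e n) (∑' n, inner ℂ (e n) x • e n) = inner ℂ (e n) x := by
    have h2 := (innerSL ℂ (e n)).hasSum hsum.hasSum
    have h3 : HasSum (fun m => innerSL ℂ (e n) (inner ℂ (e m) x • e m)) (inner ℂ (e n) x) := by
      convert hasSum_single n fun m hm => ?_ using 1
      · simp [he.1 n]
      · simp [he.2 hm.symm]
    exact h2.unique h3
  have h4 : inner ℂ (e n) ((∑' n, inner ℂ (e n) x • e n) - x) = 0 := by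
    rw [inner_sub_right, h1, sub_self]
  have h5 : Φ (s n) = ((‖Φ (s n)‖ : ℝ) : ℂ) • e n := by
    simp [e, smul_smul, hnorm n]
  change inner ℂ _ (Φ (s n)) = 0
  rw [← inner_conj_symm, h5, inner_smul_left, h4, mul_zero, map_zero]

/-- The sampling series of `z ↦ ⟪x, Φ z⟫`. -/
theorem sampling_series [CompleteSpace H] (h : IsKernelFamily Φ ω r C) {s : ℕ → ℝ}
    (hs : StrictMono s) (hZ : {t | ω t = 0} = range fun n => (s n : ℂ)) (x : H) :
    (∀ z : ℂ, HasSum (fun n => inner ℂ x (Φ (s n)) *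
      if z = s n then 1 else ω z / ((z - s n) * deriv ω (s n))) (inner ℂ x (Φ z))) ∧
    ∀ K : Set ℂ, IsCompact K → TendstoUniformlyOn
      (fun N (z : ℂ) => ∑ n ∈ Finset.range N, inner ℂ x (Φ (s n)) *
        if z = s n then 1 else ω z / ((z - s n) * deriv ω (s n)))
      (fun z => inner ℂ x (Φ z)) atTop K := by
  have hsz : ∀ n, ω (s n) = 0 := fun n => hZ.ge ⟨n, rfl⟩
  obtain ⟨y, hy, hsum⟩ := h.exists_hasSum hs hZ x
  set c : ℕ → H := fun n =>
    (inner ℂ (Φ (s n)) x / inner ℂ (Φ (s n)) (Φ (s n))) • Φ (s n) with hc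
  have hterm : ∀ n (z : ℂ), (inner ℂ x (Φ (s n)) *
      if z = s n then 1 else ω z / ((z - s n) * deriv ω (s n))) = inner ℂ (c n) (Φ z) := by
    intro n z
    rw [← h.inner_div_eq (hsz n) z]
    simp only [hc, inner_smul_left, map_div₀, inner_conj_symm]
    ring
  simp only [hterm]
  simp only [← hy]
  refine ⟨fun z => ?_, fun K hK => ?_⟩
  · have h1 := (innerSL ℂ (Φ z)).hasSum hsum
    have h2 := h1.map (starRingEnd ℂ) Complex.continuous_conj
    simpa [Function.comp_def, inner_conj_symm] using h2
  -- By Cauchy-Schwarz the error at z is at most the norm of the remainder in H times ‖Φ z‖, and the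
  -- latter is bounded on K.
  · obtain ⟨B, hB⟩ := hK.exists_bound_of_continuousOn h.differentiable.continuous.continuousOn
    rw [Metric.tendstoUniformlyOn_iff]
    intro ε hε
    have h1 := Metric.tendsto_atTop.1 hsum.tendsto_sum_nat (ε / (|B| + 1)) (by positivity)
    obtain ⟨N, hN⟩ := h1
    filter_upwards [eventually_ge_atTop N] with n hn z hz
    rw [← sum_inner, dist_comm, dist_eq_norm, ← inner_sub_left]
    have h2 := hN n hn
    rw [dist_eq_norm] at h2
    have h3 : ‖Φ z‖ < |B| + 1 := by
      have := hB z hz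
      have := le_abs_self B
      linarith
    calc _ ≤ ‖∑ i ∈ Finset.range n, c i - y‖ * ‖Φ z‖ := norm_inner_le_norm _ _
      _ ≤ ‖∑ i ∈ Finset.range n, c i - y‖ * (|B| + 1) := by gcongr
      _ < ε / (|B| + 1) * (|B| + 1) := by gcongr
      _ = ε := by field_simp

end IsKernelFamily

end SL

namespace SL

open scoped ComplexConjugate

/-! ### Solutions off a finite exceptional set: gluing, energy, Lagrange's identity, growth. -/

theorem le_of_hasDerivAt_nonneg_off_finset {f f' : ℝ → ℝ} (S : Finset ℝ) :
    ∀ {a b : ℝ}, a ≤ b → ContinuousOn f (Icc a b) →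
      (∀ x ∈ Ioo a b, x ∉ S → HasDerivAt f (f' x) x) → (∀ x ∈ Ioo a b, x ∉ S → 0 ≤ f' x) →
      f a ≤ f b := by
  induction S using Finset.induction_on with
  | empty =>
    intro a b hab hc hd hn
    refine monotoneOn_of_deriv_nonneg (convex_Icc a b) hc ?_ ?_ (left_mem_Icc.2 hab)
      (right_mem_Icc.2 hab) hab
    · rw [interior_Icc]
      exact fun x hx => (hd x hx (by simp)).differentiableAt.differentiableWithinAt
    · rw [interior_Icc]
      exact fun x hx => by rw [(hd x hx (by simp)).deriv]; exact hn x hx (by simp)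
  | insert s S _ ih =>
    intro a b hab hc hd hn
    by_cases hs : s ∈ Ioo a b
    · have h1 : ∀ x ∈ Ioo a s, x ∉ S → x ∈ Ioo a b ∧ x ∉ insert s S := fun x hx hxS =>
        ⟨⟨hx.1, hx.2.trans hs.2⟩, by simp [hx.2.ne, hxS]⟩
      have h2 : ∀ x ∈ Ioo s b, x ∉ S → x ∈ Ioo a b ∧ x ∉ insert s S := fun x hx hxS =>
        ⟨⟨hs.1.trans hx.1, hx.2⟩, by simp [hx.1.ne', hxS]⟩
      exact (ih hs.1.le (hc.mono (Icc_subset_Icc_right hs.2.le))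
        (fun x hx hxS => hd x (h1 x hx hxS).1 (h1 x hx hxS).2)
        (fun x hx hxS => hn x (h1 x hx hxS).1 (h1 x hx hxS).2)).trans
        (ih hs.2.le (hc.mono (Icc_subset_Icc_left hs.1.le))
        (fun x hx hxS => hd x (h2 x hx hxS).1 (h2 x hx hxS).2)
        (fun x hx hxS => hn x (h2 x hx hxS).1 (h2 x hx hxS).2))
    · have h1 : ∀ x ∈ Ioo a b, x ∉ S → x ∉ insert s S := fun x hx hxS => by
        rw [Finset.mem_insert, not_or]
        exact ⟨fun h => hs (h ▸ hx), hxS⟩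
      exact ih hab hc (fun x hx hxS => hd x hx (h1 x hx hxS))
        (fun x hx hxS => hn x hx (h1 x hx hxS))

/-- `u` is a `C¹` solution of `-u'' + q u = lam u` on `[a, b]` with derivative `v`; the equation is
required to hold off the exceptional set `S`. -/
structure IsSolOff (q : ℝ → ℝ) (S : Finset ℝ) (lam : ℂ) (a b : ℝ) (u v : ℝ → ℂ) : Prop where
  cont : ContinuousOn u (Icc a b)
  cont' : ContinuousOn v (Icc a b)
  hasDeriv : ∀ x ∈ Ioo a b, x ∉ S → HasDerivAt u (v x) x
  hasDeriv' : ∀ x ∈ Ioo a b, x ∉ S → HasDerivAt v ((q x - lam) * u x) x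

theorem IsSolution.isSolOff {q : ℝ → ℝ} {lam : ℂ} {c d : ℝ} {u : ℝ → ℂ}
    (h : IsSolution q lam c d u) (hcd : c < d) (S : Finset ℝ) :
    IsSolOff q S lam c d u (derivWithin u (Icc c d)) := by
  have hd : ∀ x ∈ Ioo c d, derivWithin u (Icc c d) x = deriv u x := fun x hx =>
    derivWithin_of_mem_nhds (Icc_mem_nhds hx.1 hx.2)
  refine ⟨h.contDiffOn.continuousOn, h.contDiffOn.continuousOn_derivWithin
    (uniqueDiffOn_Icc hcd) le_rfl, fun x hx _ => ?_, fun x hx _ => ?_⟩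
  · exact ((h.contDiffOn.differentiableOn one_ne_zero x
      (Ioo_subset_Icc_self hx)).hasDerivWithinAt).hasDerivAt (Icc_mem_nhds hx.1 hx.2)
  · obtain ⟨w, hw, he⟩ := h.eqn x hx
    have hw' : w = (q x - lam) * u x := by linear_combination -he
    rw [← hw']
    refine hw.congr_of_eventuallyEq ?_
    filter_upwards [Ioo_mem_nhds hx.1 hx.2] with y hy using hd y hy

namespace IsSolOff

variable {q : ℝ → ℝ} {S : Finset ℝ} {lam mu : ℂ} {a b : ℝ} {u v y z : ℝ → ℂ}

theorem mono (h : IsSolOff q S lam a b u v) {c d : ℝ} (hc : a ≤ c) (hd : d ≤ b) :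
    IsSolOff q S lam c d u v :=
  ⟨h.cont.mono (Icc_subset_Icc hc hd), h.cont'.mono (Icc_subset_Icc hc hd),
    fun x hx => h.hasDeriv x (Ioo_subset_Ioo hc hd hx),
    fun x hx => h.hasDeriv' x (Ioo_subset_Ioo hc hd hx)⟩

theorem congr_coeff {q' : ℝ → ℝ} (h : IsSolOff q S lam a b u v)
    (hq : ∀ x ∈ Ioo a b, x ∉ S → q x = q' x) : IsSolOff q' S lam a b u v :=
  ⟨h.cont, h.cont', h.hasDeriv, fun x hx hxS => hq x hx hxS ▸ h.hasDeriv' x hx hxS⟩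

theorem const_mul (h : IsSolOff q S lam a b u v) (c : ℂ) :
    IsSolOff q S lam a b (fun x => c * u x) (fun x => c * v x) :=
  ⟨continuousOn_const.mul h.cont, continuousOn_const.mul h.cont',
    fun x hx hxS => (h.hasDeriv x hx hxS).const_mul c,
    fun x hx hxS => ((h.hasDeriv' x hx hxS).const_mul c).congr_deriv (by ring)⟩

theorem sub (h : IsSolOff q S lam a b u v) (h' : IsSolOff q S lam a b y z) :
    IsSolOff q S lam a b (fun x => u x - y x) (fun x => v x - z x) :=
  ⟨h.cont.sub h'.cont, h.cont'.sub h'.cont',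
    fun x hx hxS => (h.hasDeriv x hx hxS).sub (h'.hasDeriv x hx hxS),
    fun x hx hxS => ((h.hasDeriv' x hx hxS).sub (h'.hasDeriv' x hx hxS)).congr_deriv (by ring)⟩

theorem conjugate (h : IsSolOff q S lam a b u v) :
    IsSolOff q S (conj lam) a b (fun x => conj (u x)) (fun x => conj (v x)) := by
  have hd : ∀ {f : ℝ → ℂ} {f' : ℂ} {x : ℝ}, HasDerivAt f f' x →
      HasDerivAt (fun x => (starRingEnd ℂ) (f x)) ((starRingEnd ℂ) f') x := fun hf =>
    Complex.conjCLE.toContinuousLinearMap.hasFDerivAt.comp_hasDerivAt _ hf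
  exact ⟨Complex.continuous_conj.comp_continuousOn h.cont,
    Complex.continuous_conj.comp_continuousOn h.cont',
    fun x hx hxS => hd (h.hasDeriv x hx hxS),
    fun x hx hxS => (hd (h.hasDeriv' x hx hxS)).congr_deriv (by simp)⟩

/-- Since m is exceptional, matching values of the function and of its derivative suffice; the
potential may jump at m. -/
theorem glue {m : ℝ} (ham : a ≤ m) (hmb : m ≤ b) (hmS : m ∈ S) (h : IsSolOff q S lam a m u v)
    (h' : IsSolOff q S lam m b y z) (h0 : u m = y m) (h1 : v m = z m) :
    IsSolOff q S lam a b (fun x => if x ≤ m then u x else y x)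
      (fun x => if x ≤ m then v x else z x) := by
  have hcont : ∀ {f g : ℝ → ℂ}, ContinuousOn f (Icc a m) → ContinuousOn g (Icc m b) →
      f m = g m → ContinuousOn (fun x => if x ≤ m then f x else g x) (Icc a b) := by
    intro f g hf hg hfg
    rw [← Icc_union_Icc_eq_Icc ham hmb]
    refine ContinuousOn.union_of_isClosed ?_ ?_ isClosed_Icc isClosed_Icc
    · exact hf.congr fun x hx => if_pos hx.2
    · refine hg.congr fun x hx => ?_
      rcases hx.1.eq_or_lt with rfl | h
      · simp [hfg]
      · exact if_neg (not_le.2 h)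
  have hder : ∀ {f g f' g' : ℝ → ℂ}, (∀ x ∈ Ioo a m, x ∉ S → HasDerivAt f (f' x) x) →
      (∀ x ∈ Ioo m b, x ∉ S → HasDerivAt g (g' x) x) → ∀ x ∈ Ioo a b, x ∉ S →
      HasDerivAt (fun x => if x ≤ m then f x else g x) (if x ≤ m then f' x else g' x) x := by
    intro f g f' g' hf hg x hx hxS
    rcases lt_trichotomy x m with h | h | h
    · rw [if_pos h.le]
      refine (hf x ⟨hx.1, h⟩ hxS).congr_of_eventuallyEq ?_
      filter_upwards [Iio_mem_nhds h] with t ht using if_pos (le_of_lt ht)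
    · exact absurd (h ▸ hmS) hxS
    · rw [if_neg (not_le.2 h)]
      refine (hg x ⟨h, hx.2⟩ hxS).congr_of_eventuallyEq ?_
      filter_upwards [Ioi_mem_nhds h] with t ht using if_neg (not_le.2 ht)
  refine ⟨hcont h.cont h'.cont h0, hcont h.cont' h'.cont' h1, hder h.hasDeriv h'.hasDeriv,
    fun x hx hxS => (hder h.hasDeriv' h'.hasDeriv' x hx hxS).congr_deriv ?_⟩
  split_ifs <;> rfl

/-- An exponential bound for the energy `|u'|² + σ² |u|²`. -/
theorem energy_le (h : IsSolOff q S lam a b u v) {M σ : ℝ} (hσ : 0 < σ)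
    (hM : ∀ x ∈ Ioo a b, x ∉ S → |q x| ≤ M) {x : ℝ} (hx : x ∈ Icc a b) :
    ‖v x‖ ^ 2 + σ ^ 2 * ‖u x‖ ^ 2 ≤
      Real.exp ((‖(σ : ℂ) ^ 2 - lam‖ + M) / σ * (x - a)) * (‖v a‖ ^ 2 + σ ^ 2 * ‖u a‖ ^ 2) := by
  -- The energy E has derivative 2⟨v, (σ² - λ + q)u⟩ ≤ 2k‖v‖σ‖u‖ ≤ kE, so e^{-k(t-a)}E decreases.
  -- The weight σ stays free, to be adapted to λ later.
  set k := (‖(σ : ℂ) ^ 2 - lam‖ + M) / σ with hk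
  have h' := h.mono le_rfl hx.2
  have key := le_of_hasDerivAt_nonneg_off_finset
    (f := fun t => -(Real.exp (-(k * (t - a))) * (‖v t‖ ^ 2 + σ ^ 2 * ‖u t‖ ^ 2)))
    (f' := fun t => -(Real.exp (-(k * (t - a))) * -k * (‖v t‖ ^ 2 + σ ^ 2 * ‖u t‖ ^ 2) +
      Real.exp (-(k * (t - a))) * (2 * inner ℝ (v t) ((q t - lam) * u t) +
        σ ^ 2 * (2 * inner ℝ (u t) (v t))))) S hx.1 ?_ ?_ ?_
  · simp only [sub_self, mul_zero, neg_zero, Real.exp_zero, one_mul, neg_le_neg_iff] at key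
    rw [Real.exp_neg, inv_mul_le_iff₀ (Real.exp_pos _)] at key
    exact key
  · have h1 := h'.cont
    have h2 := h'.cont'
    fun_prop
  · intro t ht htS
    have h1 := (h'.hasDeriv t ht htS).norm_sq
    have h2 := (h'.hasDeriv' t ht htS).norm_sq
    have h3 : HasDerivAt (fun t => Real.exp (-(k * (t - a)))) (Real.exp (-(k * (t - a))) * -k) t := by
      have := (((hasDerivAt_id t).sub_const a).const_mul k).neg.exp
      simpa using this
    exact (h3.mul (h2.add (h1.const_mul (σ ^ 2)))).neg
  · intro t ht htS
    have hq := hM t ⟨ht.1, ht.2.trans_le hx.2⟩ htS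
    have h1 : inner ℝ (v t) ((q t - lam) * u t) + σ ^ 2 * inner ℝ (u t) (v t) =
        inner ℝ (v t) (((σ : ℂ) ^ 2 - lam + q t) * u t) := by
      rw [real_inner_comm (v t) (u t), ← real_inner_smul_right, ← inner_add_right]
      congr 1
      rw [Complex.real_smul]
      push_cast
      ring
    have h2 : inner ℝ (v t) (((σ : ℂ) ^ 2 - lam + q t) * u t) ≤
        ‖v t‖ * ((‖(σ : ℂ) ^ 2 - lam‖ + M) * ‖u t‖) := by
      refine (real_inner_le_norm _ _).trans ?_
      rw [norm_mul]
      gcongr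
      refine (norm_add_le _ _).trans ?_
      gcongr
      simpa using hq
    have hM0 : 0 ≤ M := (abs_nonneg _).trans hq
    have h3 : ‖v t‖ * ((‖(σ : ℂ) ^ 2 - lam‖ + M) * ‖u t‖) = k * (‖v t‖ * (σ * ‖u t‖)) := by
      rw [hk]; field_simp
    have hk0 : 0 ≤ k := by positivity
    have h4 : k * (2 * (‖v t‖ * (σ * ‖u t‖))) ≤ k * (‖v t‖ ^ 2 + σ ^ 2 * ‖u t‖ ^ 2) := by
      gcongr
      nlinarith [sq_nonneg (‖v t‖ - σ * ‖u t‖)]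
    have h5 : 0 < Real.exp (-(k * (t - a))) := Real.exp_pos _
    have h6 : 0 ≤ k * (‖v t‖ ^ 2 + σ ^ 2 * ‖u t‖ ^ 2) -
        (2 * inner ℝ (v t) ((q t - lam) * u t) + σ ^ 2 * (2 * inner ℝ (u t) (v t))) := by
      linarith
    have h7 := mul_nonneg h5.le h6
    linarith

theorem eq_zero (h : IsSolOff q S lam a b u v) {M : ℝ}
    (hM : ∀ x ∈ Ioo a b, x ∉ S → |q x| ≤ M) (hu : u a = 0) (hv : v a = 0) {x : ℝ}
    (hx : x ∈ Icc a b) : u x = 0 ∧ v x = 0 := by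
  have h1 := h.energy_le one_pos hM hx
  simp only [hu, hv, norm_zero] at h1
  have h2 : ‖v x‖ ^ 2 + ‖u x‖ ^ 2 ≤ 0 := by simpa using h1
  have h3 := sq_nonneg ‖v x‖
  have h4 := sq_nonneg ‖u x‖
  constructor
  · exact norm_eq_zero.1 (pow_eq_zero_iff two_ne_zero |>.1 (by linarith))
  · exact norm_eq_zero.1 (pow_eq_zero_iff two_ne_zero |>.1 (by linarith))

/-- Uniqueness for the initial value problem. -/
theorem eqOn (h : IsSolOff q S lam a b u v) (h' : IsSolOff q S lam a b y z) {M : ℝ}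
    (hM : ∀ x ∈ Ioo a b, x ∉ S → |q x| ≤ M) (hu : u a = y a) (hv : v a = z a) {x : ℝ}
    (hx : x ∈ Icc a b) : u x = y x ∧ v x = z x := by
  have := (h.sub h').eq_zero hM (sub_eq_zero.2 hu) (sub_eq_zero.2 hv) hx
  exact ⟨sub_eq_zero.1 this.1, sub_eq_zero.1 this.2⟩

/-- Lagrange's identity. -/
theorem lagrange (hab : a ≤ b) (h : IsSolOff q S lam a b u v) (h' : IsSolOff q S mu a b y z) :
    (lam - mu) * ∫ x in a..b, u x * y x =
      (u b * z b - v b * y b) - (u a * z a - v a * y a) := by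
  rw [← intervalIntegral.integral_const_mul]
  refine integral_eq_of_hasDerivAt_off_countable_of_le (fun x => u x * z x - v x * y x) _ hab
    S.countable_toSet ((h.cont.mul h'.cont').sub (h.cont'.mul h'.cont)) (fun x hx => ?_) ?_
  · have h1 := h.hasDeriv x hx.1 hx.2
    have h2 := h.hasDeriv' x hx.1 hx.2
    have h3 := h'.hasDeriv x hx.1 hx.2
    have h4 := h'.hasDeriv' x hx.1 hx.2
    exact ((h1.mul h4).sub (h2.mul h3)).congr_deriv (by ring)
  · exact (continuousOn_const.mul (h.cont.mul h'.cont)).intervalIntegrable_of_Icc hab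

/-- The Wronskian of two solutions is constant. -/
theorem wronskian_eq (hab : a ≤ b) (h : IsSolOff q S lam a b u v)
    (h' : IsSolOff q S lam a b y z) : u a * z a - v a * y a = u b * z b - v b * y b := by
  have := h.lagrange hab h'
  rw [sub_self, zero_mul] at this
  exact (sub_eq_zero.1 this.symm).symm

/-- Growth of the solutions of `u'' = (q - t) u` when `q - t` is large. -/
theorem mul_norm_sq_le_two_mul_inner {t : ℝ} (hab : a ≤ b) (h : IsSolOff q S t a b u v) {m : ℝ}
    (hm : 1 ≤ m * (b - a)) (hm0 : 0 < m) (hq : ∀ x ∈ Ioo a b, x ∉ S → 2 * m ^ 2 ≤ q x - t)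
    (ha : 2 * |inner ℝ (u a) (v a)| ≤ m * ‖u a‖ ^ 2) :
    m * ‖u b‖ ^ 2 ≤ 2 * inner ℝ (u b) (v b) := by
  let f : ℝ → ℝ := fun x => ‖u x‖ ^ 2
  let g : ℝ → ℝ := fun x => 2 * inner ℝ (u x) (v x)
  let g' : ℝ → ℝ := fun x => 2 * (inner ℝ (u x) ((q x - t) * u x) + inner ℝ (v x) (v x))
  have hf : ∀ x ∈ Ioo a b, x ∉ S → HasDerivAt f (g x) x := fun x hx hxS =>
    (h.hasDeriv x hx hxS).norm_sq
  have hg : ∀ x ∈ Ioo a b, x ∉ S → HasDerivAt g (g' x) x := fun x hx hxS =>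
    ((h.hasDeriv x hx hxS).inner ℝ (h.hasDeriv' x hx hxS)).const_mul 2
  have hfg : ∀ x ∈ Ioo a b, x ∉ S → 4 * m ^ 2 * f x ≤ g' x := fun x hx hxS => by
    have h1 : inner ℝ (u x) ((q x - t : ℂ) * u x) = (q x - t) * ‖u x‖ ^ 2 := by
      rw [← real_inner_self_eq_norm_sq, ← real_inner_smul_right, Complex.real_smul]
      push_cast
      rfl
    have h2 : 0 ≤ inner ℝ (v x) (v x) := real_inner_self_nonneg
    have h3 : 2 * m ^ 2 * ‖u x‖ ^ 2 ≤ (q x - t) * ‖u x‖ ^ 2 := by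
      gcongr; exact hq x hx hxS
    simp only [f, g', h1]
    linarith
  have hfc : ContinuousOn f (Icc a b) := h.cont.norm.pow 2
  have hgc : ContinuousOn g (Icc a b) := continuousOn_const.mul (h.cont.inner h.cont')
  -- With f = ‖u‖² and g = f', the inequality f'' ≥ 4m²f factors: e^{-c(x-a)}(g + cf) is
  -- nondecreasing for both roots c = ±2m.
  have key : ∀ c : ℝ, c ^ 2 = 4 * m ^ 2 →
      g a + c * f a ≤ Real.exp (-(c * (b - a))) * (g b + c * f b) := by
    intro c hc
    have := le_of_hasDerivAt_nonneg_off_finset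
      (f := fun x => Real.exp (-(c * (x - a))) * (g x + c * f x))
      (f' := fun x => Real.exp (-(c * (x - a))) * -c * (g x + c * f x) +
        Real.exp (-(c * (x - a))) * (g' x + c * g x)) S hab (by fun_prop) (fun x hx hxS => ?_)
      (fun x hx hxS => ?_)
    · simpa using this
    · have h3 : HasDerivAt (fun x => Real.exp (-(c * (x - a))))
          (Real.exp (-(c * (x - a))) * -c) x := by
        simpa using (((hasDerivAt_id x).sub_const a).const_mul c).neg.exp
      exact h3.mul ((hg x hx hxS).add ((hf x hx hxS).const_mul c))
    · have h1 : 0 ≤ g' x - c ^ 2 * f x := by rw [hc]; linarith [hfg x hx hxS]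
      have h2 := mul_nonneg (Real.exp_pos (-(c * (x - a)))).le h1
      linarith
  have k1 := key (2 * m) (by ring)
  have k2 := key (-(2 * m)) (by ring)
  rw [Real.exp_neg] at k1
  rw [neg_mul (2 * m) (b - a), neg_neg] at k2
  set X := Real.exp (2 * m * (b - a)) with hX
  have hX3 : 3 ≤ X := by
    have := Real.add_one_le_exp (2 * m * (b - a))
    linarith
  have hX0 : 0 < X := by linarith
  rw [le_inv_mul_iff₀ hX0] at k1
  have hga : |g a| ≤ m * f a := by
    simpa only [f, g, abs_mul, abs_two] using ha
  obtain ⟨l1, l2⟩ := abs_le.1 hga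
  have hfa : 0 ≤ m * f a := by positivity
  change m * f b ≤ g b
  have e1 : X * (m * f a) ≤ g b + 2 * m * f b := by nlinarith
  have e2 : -(3 * (m * f a)) ≤ X * (g b - 2 * m * f b) := by nlinarith
  have e3 : -(3 * (g b + 2 * m * f b)) ≤ X ^ 2 * (g b - 2 * m * f b) := by nlinarith
  have hpos : 0 ≤ g b + 2 * m * f b := by nlinarith
  by_contra hlt
  push Not at hlt
  have e4 : g b - 2 * m * f b < 0 := by
    have : 0 ≤ m * f b := by positivity
    linarith
  -- By `e3`, (X² + 3) g(b) ≥ 2m(X² - 3) f(b). As (X² - 3)/(X² + 3) ≥ 1/2 exactly when X² ≥ 9, this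
  -- yields g(b) ≥ m f(b).
  have e5 : 9 ≤ X ^ 2 := by nlinarith
  nlinarith

end IsSolOff

/-- Solutions of `-u'' + q u = lam u` on an open interval for distinct values of `lam` are linearly
independent. -/
theorem eq_zero_of_sum_mul_eq_zero {ι : Type*} {q : ℝ → ℝ} {c d : ℝ} {mu : ι → ℂ}
    (hmu : Function.Injective mu) {u v : ι → ℝ → ℂ}
    (hu : ∀ i, ∀ x ∈ Ioo c d, HasDerivAt (u i) (v i x) x)
    (hv : ∀ i, ∀ x ∈ Ioo c d, HasDerivAt (v i) ((q x - mu i) * u i x) x)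
    (hne : ∀ i, ∃ x ∈ Ioo c d, u i x ≠ 0) (s : Finset ι) :
    ∀ k : ι → ℂ, (∀ x ∈ Ioo c d, ∑ i ∈ s, k i * u i x = 0) → ∀ i ∈ s, k i = 0 := by
  classical
  have hzero : ∀ {f : ℝ → ℂ} {f' : ℝ → ℂ}, (∀ x ∈ Ioo c d, HasDerivAt f (f' x) x) →
      (∀ x ∈ Ioo c d, f x = 0) → ∀ x ∈ Ioo c d, f' x = 0 := by
    intro f f' hf h0 x hx
    refine (hf x hx).unique ((hasDerivAt_const x (0 : ℂ)).congr_of_eventuallyEq ?_)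
    filter_upwards [Ioo_mem_nhds hx.1 hx.2] with t ht using h0 t ht
  induction s using Finset.induction_on with
  | empty => simp
  | insert j s hj ih =>
    intro k hk
    have h1 := hzero (fun x hx => HasDerivAt.fun_sum fun i (_ : i ∈ insert j s) =>
      (hu i x hx).const_mul (k i)) hk
    have h2 := hzero (fun x hx => HasDerivAt.fun_sum fun i (_ : i ∈ insert j s) =>
      (hv i x hx).const_mul (k i)) h1
    -- The operator -d²/dx² + q - μ_j annihilates the j-th term and multiplies the i-th by μ_i - μ_j
    -- ≠ 0, which shortens the relation.
    have h3 : ∀ x ∈ Ioo c d, ∑ i ∈ s, (k i * (mu i - mu j)) * u i x = 0 := fun x hx => by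
      have e : ∑ i ∈ insert j s, (k i * (mu i - mu j)) * u i x = 0 := by
        calc _ = (q x - mu j) * ∑ i ∈ insert j s, k i * u i x -
              ∑ i ∈ insert j s, k i * ((q x - mu i) * u i x) := by
              rw [Finset.mul_sum, ← Finset.sum_sub_distrib]
              exact Finset.sum_congr rfl fun i _ => by ring
          _ = 0 := by rw [hk x hx, h2 x hx]; simp
      rwa [Finset.sum_insert hj, sub_self, mul_zero, zero_mul, zero_add] at e
    have h4 : ∀ i ∈ s, k i = 0 := fun i hi =>
      (mul_eq_zero.1 (ih _ h3 i hi)).resolve_right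
        (sub_ne_zero.2 fun he => hj (hmu he ▸ hi))
    have h5 : k j = 0 := by
      obtain ⟨x, hx, hxne⟩ := hne j
      have := hk x hx
      rw [Finset.sum_insert hj, Finset.sum_eq_zero fun i hi => by rw [h4 i hi, zero_mul],
        add_zero] at this
      exact (mul_eq_zero.1 this).resolve_right hxne
    intro i hi
    rcases Finset.mem_insert.1 hi with rfl | hi
    · exact h5
    · exact h4 i hi

end SL

namespace SL

theorem intervalIntegrable_ofReal {q : ℝ → ℝ} {c d : ℝ} (h : IntervalIntegrable q volume c d) :
    IntervalIntegrable (fun t => (q t : ℂ)) volume c d :=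
  ⟨h.1.ofReal, h.2.ofReal⟩

/-! ### Holomorphic dependence on the spectral parameter. -/

section Volterra

variable {a b : ℝ} (hab : a ≤ b) {p : ℝ → ℂ} {M : ℝ}

theorem intervalIntegrable_mul_extend (hp : ∀ c d, IntervalIntegrable p volume c d)
    (f : C(Icc a b, ℂ)) (c d : ℝ) :
    IntervalIntegrable (fun t => p t * f (projIcc a b hab t)) volume c d :=
  (hp c d).mul_continuousOn (f.continuous.comp continuous_projIcc).continuousOn

theorem intervalIntegrable_volterra (hp : ∀ c d, IntervalIntegrable p volume c d)
    (f : C(Icc a b, ℂ)) (x c d : ℝ) :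
    IntervalIntegrable (fun t => ((x : ℂ) - t) * (p t * f (projIcc a b hab t))) volume c d :=
  (intervalIntegrable_mul_extend hab hp f c d).continuousOn_mul (by fun_prop)

/-- Each application raises the power of x - a and divides by n + 1; iteration produces the
factorial that makes the Neumann series converge for every λ. -/
theorem norm_volterra_le (hM : ∀ t, ‖p t‖ ≤ M) {f : C(Icc a b, ℂ)} {c : ℝ} {n : ℕ}
    (hf : ∀ x : Icc a b, ‖f x‖ ≤ c * (x - a) ^ n) (x : Icc a b) :
    ‖∫ t in a..x, (((x : ℝ) : ℂ) - t) * (p t * f (projIcc a b hab t))‖ ≤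
      (b - a) * M * c * (x - a) ^ (n + 1) / (n + 1) := by
  have hM0 : 0 ≤ M := (norm_nonneg _).trans (hM 0)
  have h1 : ∫ t in a..(x : ℝ), (b - a) * M * c * (t - a) ^ n =
      (b - a) * M * c * (x - a) ^ (n + 1) / (n + 1) := by
    rw [intervalIntegral.integral_const_mul,
      intervalIntegral.integral_comp_sub_right (fun t => t ^ n) a, integral_pow]
    simp
    ring
  rw [← h1]
  refine intervalIntegral.norm_integral_le_of_norm_le x.2.1 (Eventually.of_forall fun t ht => ?_)
    (Continuous.intervalIntegrable (by fun_prop) _ _)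
  have ht' : t ∈ Icc a b := ⟨ht.1.le, ht.2.trans x.2.2⟩
  have h2 := hf ⟨t, ht'⟩
  have h3 : ‖((x : ℝ) : ℂ) - t‖ ≤ b - a := by
    rw [← Complex.ofReal_sub, Complex.norm_real, Real.norm_eq_abs, abs_of_nonneg (by linarith [ht.2])]
    linarith [x.2.2, ht.1]
  rw [norm_mul, norm_mul, projIcc_of_mem hab ht', mul_assoc ((b - a) * M), mul_assoc (b - a)]
  gcongr
  exact hM t

/-- The Volterra operator with kernel `(x - t) p(t)`. -/
noncomputable def volterra (hp : ∀ c d, IntervalIntegrable p volume c d)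
    (hM : ∀ t, ‖p t‖ ≤ M) : C(Icc a b, ℂ) →L[ℂ] C(Icc a b, ℂ) :=
  LinearMap.mkContinuous
    { toFun := fun f =>
        ⟨fun x => ∫ t in a..x, (((x : ℝ) : ℂ) - t) * (p t * f (projIcc a b hab t)), by
          have h1 := intervalIntegrable_mul_extend hab hp f
          have h2 : ∀ c d, IntervalIntegrable
              (fun t => (t : ℂ) * (p t * f (projIcc a b hab t))) volume c d := fun c d =>
            (h1 c d).continuousOn_mul (by fun_prop)
          have h3 : (fun x : Icc a b =>
              ∫ t in a..x, (((x : ℝ) : ℂ) - t) * (p t * f (projIcc a b hab t))) =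
              fun x : Icc a b => ((x : ℝ) : ℂ) * (∫ t in a..x, p t * f (projIcc a b hab t)) -
                ∫ t in a..x, (t : ℂ) * (p t * f (projIcc a b hab t)) := by
            funext x
            rw [← intervalIntegral.integral_const_mul, ← intervalIntegral.integral_sub
              ((h1 _ _).const_mul _) (h2 _ _)]
            simp only [sub_mul]
          rw [h3]
          exact ((Complex.continuous_ofReal.comp continuous_subtype_val).mul
            ((intervalIntegral.continuous_primitive h1 a).comp continuous_subtype_val)).sub
            ((intervalIntegral.continuous_primitive h2 a).comp continuous_subtype_val)⟩
      map_add' := fun f g => by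
        ext x
        simp only [ContinuousMap.coe_mk, ContinuousMap.add_apply]
        rw [← intervalIntegral.integral_add (intervalIntegrable_volterra hab hp f x _ _)
          (intervalIntegrable_volterra hab hp g x _ _)]
        simp only [mul_add]
      map_smul' := fun c f => by
        ext x
        simp only [ContinuousMap.coe_mk, ContinuousMap.smul_apply, RingHom.id_apply, smul_eq_mul]
        rw [← intervalIntegral.integral_const_mul]
        congr 1
        funext t
        ring }
    ((b - a) * M * (b - a)) fun f => by
      have hM0 : 0 ≤ M := (norm_nonneg _).trans (hM 0)
      have hab0 : 0 ≤ b - a := by linarith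
      refine (ContinuousMap.norm_le _ (by positivity)).2 fun x => ?_
      have h1 := norm_volterra_le hab hM (f := f) (c := ‖f‖) (n := 0)
        (fun x => by simpa using f.norm_coe_le_norm x) x
      refine h1.trans ?_
      have h2 : (x : ℝ) - a ≤ b - a := by linarith [x.2.2]
      calc (b - a) * M * ‖f‖ * (x - a) ^ (0 + 1) / ((0 : ℕ) + 1) =
            (b - a) * M * ‖f‖ * (x - a) := by simp
        _ ≤ (b - a) * M * ‖f‖ * (b - a) := by gcongr
        _ = _ := by ring

theorem volterra_apply (hp : ∀ c d, IntervalIntegrable p volume c d)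
    (hM : ∀ t, ‖p t‖ ≤ M) (f : C(Icc a b, ℂ)) (x : Icc a b) :
    volterra hab hp hM f x =
      ∫ t in a..x, (((x : ℝ) : ℂ) - t) * (p t * f (projIcc a b hab t)) := rfl

theorem norm_volterra_pow_le (hp : ∀ c d, IntervalIntegrable p volume c d)
    (hM : ∀ t, ‖p t‖ ≤ M) (f : C(Icc a b, ℂ)) (n : ℕ) :
    ‖(volterra hab hp hM ^ n) f‖ ≤ ‖f‖ * (((b - a) * M * (b - a)) ^ n / n.factorial) := by
  have hM0 : 0 ≤ M := (norm_nonneg _).trans (hM 0)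
  have hab0 : 0 ≤ b - a := by linarith
  have key : ∀ x : Icc a b, ‖(volterra hab hp hM ^ n) f x‖ ≤
      ‖f‖ * ((b - a) * M) ^ n / n.factorial * (x - a) ^ n := by
    induction n with
    | zero => intro x; simpa using f.norm_coe_le_norm x
    | succ n ih =>
      intro x
      rw [pow_succ', mul_apply_eq_comp, volterra_apply]
      refine (norm_volterra_le hab hM ih x).trans (le_of_eq ?_)
      rw [Nat.factorial_succ]
      push_cast
      field_simp
      ring
  refine (ContinuousMap.norm_le _ (by positivity)).2 fun x => (key x).trans ?_
  have h2 : (x : ℝ) - a ≤ b - a := by linarith [x.2.2]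
  have h3 : 0 ≤ (x : ℝ) - a := by linarith [x.2.1]
  calc _ ≤ ‖f‖ * ((b - a) * M) ^ n / n.factorial * (b - a) ^ n := by gcongr
    _ = _ := by rw [mul_pow _ (b - a)]; ring

/-- Solutions of Volterra equations with coefficient `q - lam` depend holomorphically on `lam`. -/
theorem differentiable_of_volterra {q : ℝ → ℝ} (hq : ∀ c d, IntervalIntegrable q volume c d)
    (hM : ∀ t, |q t| ≤ M) (f₀ : C(Icc a b, ℂ)) {f : ℂ → C(Icc a b, ℂ)}
    (hf : ∀ lam (x : Icc a b), f lam x = f₀ x +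
      ∫ t in a..x, (((x : ℝ) : ℂ) - t) * ((q t - lam) * f lam (projIcc a b hab t))) :
    Differentiable ℂ f := by
  have hq' : ∀ c d, IntervalIntegrable (fun t => (q t : ℂ)) volume c d := fun c d =>
    intervalIntegrable_ofReal (hq c d)
  have h1' : ∀ c d, IntervalIntegrable (fun _ => (1 : ℂ)) volume c d := fun c d =>
    intervalIntegrable_const
  have hM' : ∀ t, ‖(q t : ℂ)‖ ≤ M := fun t => by simpa using hM t
  have hpl : ∀ (lam : ℂ) c d, IntervalIntegrable (fun t => (q t : ℂ) - lam) volume c d :=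
    fun lam c d => (hq' c d).sub intervalIntegrable_const
  have hMl : ∀ (lam : ℂ) t, ‖(q t : ℂ) - lam‖ ≤ M + ‖lam‖ := fun lam t =>
    (norm_sub_le _ _).trans (by gcongr; exact hM' t)
  let A := volterra hab hq' hM'
  let B := volterra hab h1' (M := 1) (fun _ => by simp)
  -- The operator is affine in λ, so each term of the Neumann series is holomorphic (indeed
  -- polynomial) in λ.
  let T : ℂ → C(Icc a b, ℂ) →L[ℂ] C(Icc a b, ℂ) := fun lam => A - lam • B
  have hT : ∀ lam, T lam = volterra hab (hpl lam) (hMl lam) := fun lam => by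
    ext g x
    simp only [T, A, B, sub_apply, smul_apply,
      ContinuousMap.sub_apply, ContinuousMap.smul_apply, volterra_apply, smul_eq_mul]
    rw [← intervalIntegral.integral_const_mul, ← intervalIntegral.integral_sub
      (intervalIntegrable_volterra hab hq' g x _ _)
      ((intervalIntegrable_volterra hab h1' g x _ _).const_mul _)]
    congr 1
    funext t
    ring
  have hTd : ∀ n, Differentiable ℂ fun lam => (T lam ^ n) f₀ := by
    intro n
    induction n with
    | zero => simp
    | succ n ih =>
      simp only [pow_succ', mul_apply_eq_comp, T, sub_apply, smul_apply]
      exact (A.differentiable.comp ih).sub (differentiable_id.smul (B.differentiable.comp ih))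
  have hbound : ∀ lam g n, ‖(T lam ^ n) g‖ ≤
      ‖g‖ * (((b - a) * (M + ‖lam‖) * (b - a)) ^ n / n.factorial) := fun lam g n => by
    rw [hT]
    exact norm_volterra_pow_le hab (hpl lam) (hMl lam) g n
  have hfix : ∀ lam, f lam = f₀ + T lam (f lam) := fun lam => by
    rw [hT]
    ext x
    exact hf lam x
  -- The family f is given as a fixed point, so the partial sums differ from it by Tᴺ f → 0, and no
  -- separate uniqueness argument is needed.
  have hiter : ∀ lam N, f lam = ∑ n ∈ Finset.range N, (T lam ^ n) f₀ + (T lam ^ N) (f lam) := by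
    intro lam N
    induction N with
    | zero => simp
    | succ N ih =>
      conv_lhs => rw [ih, hfix lam]
      rw [Finset.sum_range_succ, pow_succ, mul_apply_eq_comp, map_add, add_assoc]
  have hsummable : ∀ c : ℝ, ∀ k : ℝ, Summable fun n : ℕ => c * (k ^ n / n.factorial) :=
    fun c k => (Real.summable_pow_div_factorial k).mul_left c
  have hsum : ∀ lam, f lam = ∑' n, (T lam ^ n) f₀ := fun lam => by
    have h1 : Tendsto (fun N => (T lam ^ N) (f lam)) atTop (𝓝 0) :=
      squeeze_zero_norm (hbound lam (f lam)) (hsummable _ _).tendsto_atTop_zero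
    have h2 : Summable fun n => (T lam ^ n) f₀ :=
      .of_norm_bounded (hsummable _ _) (hbound lam f₀)
    have h3 := h2.hasSum.tendsto_sum_nat.add h1
    simp only [← hiter, add_zero] at h3
    exact tendsto_nhds_unique tendsto_const_nhds h3
  have hM0 : 0 ≤ M := (abs_nonneg _).trans (hM 0)
  have hab0 : 0 ≤ b - a := by linarith
  intro lam
  have hd : DifferentiableOn ℂ (fun lam => ∑' n, (T lam ^ n) f₀) (Metric.ball 0 (‖lam‖ + 1)) := by
    refine Complex.differentiableOn_tsum_of_summable_norm
      (hsummable ‖f₀‖ ((b - a) * (M + (‖lam‖ + 1)) * (b - a))) (fun n => ?_) Metric.isOpen_ball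
      fun n w hw => (hbound w f₀ n).trans ?_
    · exact (hTd n).differentiableOn
    · have := (mem_ball_zero_iff.1 hw).le
      gcongr
  simp only [← hsum] at hd
  exact hd.differentiableAt (Metric.isOpen_ball.mem_nhds (by simp))

/-- Integration against an integrable function, as a functional on continuous functions. -/
theorem exists_clm_integral (hp : ∀ c d, IntervalIntegrable p volume c d)
    (hM : ∀ t, ‖p t‖ ≤ M) : ∃ ψ : C(Icc a b, ℂ) →L[ℂ] ℂ,
      ∀ f, ψ f = ∫ t in a..b, p t * f (projIcc a b hab t) := by
  refine ⟨LinearMap.mkContinuous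
    { toFun := fun f => ∫ t in a..b, p t * f (projIcc a b hab t)
      map_add' := fun f g => ?_
      map_smul' := fun c f => ?_ } (M * |b - a|) fun f => ?_, fun f => rfl⟩
  · rw [← intervalIntegral.integral_add (intervalIntegrable_mul_extend hab hp f _ _)
      (intervalIntegrable_mul_extend hab hp g _ _)]
    simp only [ContinuousMap.add_apply, mul_add]
  · rw [RingHom.id_apply, smul_eq_mul, ← intervalIntegral.integral_const_mul]
    congr 1
    funext t
    simp only [ContinuousMap.smul_apply, smul_eq_mul]
    ring
  · have hM0 : 0 ≤ M := (norm_nonneg _).trans (hM 0)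
    rw [mul_right_comm]
    refine intervalIntegral.norm_integral_le_of_norm_le_const fun t _ => ?_
    rw [norm_mul]
    gcongr
    · exact hM t
    · exact f.norm_coe_le_norm _

end Volterra

/-- A family of solutions with fixed Cauchy data at `a` depends holomorphically on `lam`. -/
theorem differentiable_of_isSolOff {q : ℝ → ℝ} {S : Finset ℝ} {a b M : ℝ} (hab : a ≤ b)
    (hq : ∀ c d, IntervalIntegrable q volume c d) (hM : ∀ t, |q t| ≤ M) {A B : ℂ}
    {u v : ℂ → ℝ → ℂ} (h : ∀ lam, IsSolOff q S lam a b (u lam) (v lam))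
    (hA : ∀ lam, u lam a = A) (hB : ∀ lam, v lam a = B) {f : ℂ → C(Icc a b, ℂ)}
    (hf : ∀ lam (x : Icc a b), f lam x = u lam x) :
    Differentiable ℂ f ∧ Differentiable ℂ fun lam => v lam b := by
  have hext : ∀ lam, ∀ t ∈ Icc a b, f lam (projIcc a b hab t) = u lam t := fun lam t ht => by
    rw [projIcc_of_mem hab ht, hf]
  have hpl : ∀ (lam : ℂ) c d, IntervalIntegrable (fun t => (q t : ℂ) - lam) volume c d :=
    fun lam c d => (intervalIntegrable_ofReal (hq c d)).sub intervalIntegrable_const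
  have hd : Differentiable ℂ f := by
    refine differentiable_of_volterra hab hq hM
      ⟨fun x : Icc a b => A + B * ((x : ℝ) - a), by fun_prop⟩ fun lam x => ?_
    have hl := (h lam).mono le_rfl x.2.2
    -- Taylor's formula with integral remainder: t ↦ u(t) + (x - t)v(t) has derivative (x - t)v'(t),
    -- and runs from A + B(x - a) to u(x).
    have key := integral_eq_of_hasDerivAt_off_countable_of_le
      (fun t => u lam t + ((x : ℝ) - t) * v lam t)
      (fun t => (((x : ℝ) : ℂ) - t) * ((q t - lam) * f lam (projIcc a b hab t))) x.2.1
      S.countable_toSet (by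
        have h1 := hl.cont
        have h2 := hl.cont'
        fun_prop) (fun t ht => by
        have h1 := hl.hasDeriv t ht.1 ht.2
        have h2 := hl.hasDeriv' t ht.1 ht.2
        have h3 : HasDerivAt (fun t : ℝ => ((x : ℝ) : ℂ) - t) (-1) t := by
          simpa using (hasDerivAt_id t).ofReal_comp.const_sub ((x : ℝ) : ℂ)
        rw [hext lam t ⟨ht.1.1.le, ht.1.2.le.trans x.2.2⟩]
        exact (h1.add (h3.mul h2)).congr_deriv (by ring))
      (intervalIntegrable_volterra hab (hpl lam) _ _ _ _)
    rw [key, hf, hA, hB, ContinuousMap.coe_mk]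
    ring
  refine ⟨hd, ?_⟩
  obtain ⟨ψ, hψ⟩ := exists_clm_integral hab (p := fun t => (q t : ℂ)) (M := M)
    (fun c d => intervalIntegrable_ofReal (hq c d)) fun t => by simpa using hM t
  obtain ⟨ψ₁, hψ₁⟩ := exists_clm_integral hab (p := fun _ => (1 : ℂ)) (M := 1)
    (fun c d => intervalIntegrable_const) fun t => by simp
  have hv : ∀ lam, v lam b = B + (ψ (f lam) - lam * ψ₁ (f lam)) := fun lam => by
    have key := integral_eq_of_hasDerivAt_off_countable_of_le (v lam)
      (fun t => (q t - lam) * f lam (projIcc a b hab t)) hab S.countable_toSet (h lam).cont'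
      (fun t ht => by
        rw [hext lam t (Ioo_subset_Icc_self ht.1)]
        exact (h lam).hasDeriv' t ht.1 ht.2)
      (intervalIntegrable_mul_extend hab (hpl lam) _ _ _)
    rw [hψ, hψ₁, ← intervalIntegral.integral_const_mul, ← intervalIntegral.integral_sub
      (intervalIntegrable_mul_extend hab (fun c d => intervalIntegrable_ofReal (hq c d)) _ _ _)
      ((intervalIntegrable_mul_extend hab (fun c d => intervalIntegrable_const) _ _ _).const_mul _)]
    rw [← sub_eq_iff_eq_add', ← hB lam, ← key]
    congr 1
    funext t
    ring
  simp only [hv]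
  exact (differentiable_const B).add ((ψ.differentiable.comp hd).sub
    (differentiable_id.mul (ψ₁.differentiable.comp hd)))

end SL

namespace SL

/-! ### The glued problem: φ, its Wronskian, the eigenvalues and the growth of φ. -/

/-- A continuous function on an open interval with finite limits at the end points is bounded and
integrable. -/
theorem bounded_and_integrableOn_Ioo {q : ℝ → ℝ} {c d : ℝ} (hq : ContinuousOn q (Ioo c d))
    (hc : ∃ l, Tendsto q (𝓝[>] c) (𝓝 l)) (hd : ∃ l, Tendsto q (𝓝[<] d) (𝓝 l)) :
    (∃ M, ∀ x ∈ Ioo c d, |q x| ≤ M) ∧ IntegrableOn q (Ioo c d) := by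
  obtain ⟨lc, hlc⟩ := hc
  obtain ⟨ld, hld⟩ := hd
  have hQ : ContinuousOn (extendFrom (Ioo c d) q) (Icc c d) :=
    continuousOn_Icc_extendFrom_Ioo hq hlc hld
  have he : ∀ x ∈ Ioo c d, extendFrom (Ioo c d) q x = q x := fun x hx => extendFrom_extends hq x hx
  constructor
  · obtain ⟨M, hM⟩ := isCompact_Icc.exists_bound_of_continuousOn hQ
    exact ⟨M, fun x hx => he x hx ▸ hM x (Ioo_subset_Icc_self hx)⟩
  · exact (hQ.integrableOn_Icc.mono_set Ioo_subset_Icc_self).congr_fun he measurableSet_Ioo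

namespace Problem

variable (P : Problem)

theorem a_lt_b : P.a < P.b := P.a_lt.trans (P.θm_lt.trans P.lt_b)

/-- The discontinuity points. -/
noncomputable def jumps : Finset ℝ := {P.θm, P.θp}

theorem mem_jumps_left : P.θm ∈ P.jumps := by simp [jumps]

theorem mem_jumps_right : P.θp ∈ P.jumps := by simp [jumps]

/-- The potential, cut off to the three open subintervals. -/
noncomputable def potential : ℝ → ℝ :=
  indicator (Ioo P.a P.θm ∪ Ioo P.θm P.θp ∪ Ioo P.θp P.b) P.q

theorem potential_eq {x : ℝ} (hx : x ∈ Ioo P.a P.b) (hxS : x ∉ P.jumps) :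
    P.q x = P.potential x := by
  simp only [jumps, Finset.mem_insert, Finset.mem_singleton, not_or] at hxS
  refine (indicator_of_mem ?_ _).symm
  rcases lt_or_gt_of_ne hxS.1 with h | h
  · exact .inl (.inl ⟨hx.1, h⟩)
  · rcases lt_or_gt_of_ne hxS.2 with h' | h'
    · exact .inl (.inr ⟨h, h'⟩)
    · exact .inr ⟨h', hx.2⟩

theorem potential_bounded_and_integrable :
    (∃ M, ∀ x, |P.potential x| ≤ M) ∧ Integrable P.potential := by
  obtain ⟨⟨ML, hL⟩, iL⟩ := bounded_and_integrableOn_Ioo (c := P.a) (d := P.θm)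
    (P.q_contL.mono Ioo_subset_Ico_self)
    ⟨_, ((P.q_contL P.a ⟨le_rfl, P.a_lt⟩).mono Ioo_subset_Ico_self).tendsto.mono_left
      (nhdsWithin_Ioo_eq_nhdsGT P.a_lt).ge⟩ P.q_limL_left
  obtain ⟨⟨MM, hM⟩, iM⟩ := bounded_and_integrableOn_Ioo (c := P.θm) (d := P.θp)
    P.q_contM P.q_limL_right P.q_limR_left
  obtain ⟨⟨MR, hR⟩, iR⟩ := bounded_and_integrableOn_Ioo (c := P.θp) (d := P.b)
    (P.q_contR.mono Ioo_subset_Ioc_self) P.q_limR_right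
    ⟨_, ((P.q_contR P.b ⟨P.lt_b, le_rfl⟩).mono Ioo_subset_Ioc_self).tendsto.mono_left
      (nhdsWithin_Ioo_eq_nhdsLT P.lt_b).ge⟩
  refine ⟨⟨|ML| + |MM| + |MR|, fun x => ?_⟩, ?_⟩
  · have h1 := abs_nonneg ML
    have h2 := abs_nonneg MM
    have h3 := abs_nonneg MR
    by_cases hx : x ∈ Ioo P.a P.θm ∪ Ioo P.θm P.θp ∪ Ioo P.θp P.b
    · rw [potential, indicator_of_mem hx]
      rcases hx with (hx | hx) | hx
      · linarith [hL x hx, le_abs_self ML]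
      · linarith [hM x hx, le_abs_self MM]
      · linarith [hR x hx, le_abs_self MR]
    · rw [potential, indicator_of_notMem hx, abs_zero]
      linarith
  · exact (integrable_indicator_iff
      ((measurableSet_Ioo.union measurableSet_Ioo).union measurableSet_Ioo)).2
      ((iL.union iM).union iR)

/-- The function on `[a, b]` with the three given pieces, weighted so that the transmission
conditions become continuity of the function and of its derivative. -/
noncomputable def glue (uL uM uR : ℝ → ℂ) (x : ℝ) : ℂ :=
  if x ≤ P.θm then uL x else if x ≤ P.θp then P.δ * uM x else P.γ * uR x

section Glue

variable (uL uM uR : ℝ → ℂ)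

theorem glue_a : P.glue uL uM uR P.a = uL P.a := if_pos P.a_lt.le

theorem glue_b : P.glue uL uM uR P.b = P.γ * uR P.b := by
  rw [glue, if_neg (not_le.2 (P.θm_lt.trans P.lt_b)), if_neg (not_le.2 P.lt_b)]

theorem glue_of_le {x : ℝ} (hx : x ≤ P.θm) : P.glue uL uM uR x = uL x := if_pos hx

theorem glue_of_mem {x : ℝ} (hx : x ∈ Ioc P.θm P.θp) : P.glue uL uM uR x = P.δ * uM x := by
  rw [glue, if_neg (not_le.2 hx.1), if_pos hx.2]

theorem glue_of_gt {x : ℝ} (hx : P.θp < x) : P.glue uL uM uR x = P.γ * uR x := by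
  rw [glue, if_neg (not_le.2 (P.θm_lt.trans hx)), if_neg (not_le.2 hx)]

variable {uL uM uR} {lam : ℂ}

theorem isSolOff_glue (hL : IsSolution P.q lam P.a P.θm uL)
    (hM : IsSolution P.q lam P.θm P.θp uM) (hR : IsSolution P.q lam P.θp P.b uR)
    (h1 : uL P.θm = P.δ * uM P.θm) (h2 : P.DL uL P.θm = P.δ * P.DM uM P.θm)
    (h3 : P.δ * uM P.θp = P.γ * uR P.θp) (h4 : P.δ * P.DM uM P.θp = P.γ * P.DR uR P.θp) :
    IsSolOff P.potential P.jumps lam P.a P.b (P.glue uL uM uR)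
      (P.glue (P.DL uL) (P.DM uM) (P.DR uR)) := by
  refine IsSolOff.congr_coeff ?_ fun x hx hxS => P.potential_eq hx hxS
  have hL' := hL.isSolOff P.a_lt P.jumps
  have hM' := (hM.isSolOff P.θm_lt P.jumps).const_mul P.δ
  have hR' := (hR.isSolOff P.lt_b P.jumps).const_mul P.γ
  refine hL'.glue P.a_lt.le (P.θm_lt.trans P.lt_b).le P.mem_jumps_left
    (hM'.glue P.θm_lt.le P.lt_b.le P.mem_jumps_right hR' h3 h4) ?_ ?_
  · rw [if_pos P.θm_lt.le, h1]
  · rw [if_pos P.θm_lt.le]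
    exact h2

end Glue

variable (lam : ℂ)

theorem phiL_spec : IsSolution P.q lam P.a P.θm (P.phiL lam) ∧ P.phiL lam P.a = P.β₂ ∧
    P.DL (P.phiL lam) P.a = -P.β₁ :=
  (P.existsL lam (left_mem_Icc.2 P.a_lt.le) P.β₂ (-P.β₁)).choose_spec

theorem phiM_spec : IsSolution P.q lam P.θm P.θp (P.phiM lam) ∧
    P.phiM lam P.θm = (P.δ : ℂ)⁻¹ * P.phiL lam P.θm ∧
    P.DM (P.phiM lam) P.θm = (P.δ : ℂ)⁻¹ * P.DL (P.phiL lam) P.θm :=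
  (P.existsM lam (left_mem_Icc.2 P.θm_lt.le) ((P.δ : ℂ)⁻¹ * P.phiL lam P.θm)
    ((P.δ : ℂ)⁻¹ * P.DL (P.phiL lam) P.θm)).choose_spec

theorem phiR_spec : IsSolution P.q lam P.θp P.b (P.phiR lam) ∧
    P.phiR lam P.θp = P.δ * (P.γ : ℂ)⁻¹ * P.phiM lam P.θp ∧
    P.DR (P.phiR lam) P.θp = P.δ * (P.γ : ℂ)⁻¹ * P.DM (P.phiM lam) P.θp :=
  (P.existsR lam (left_mem_Icc.2 P.lt_b.le) (P.δ * (P.γ : ℂ)⁻¹ * P.phiM lam P.θp)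
    (P.δ * (P.γ : ℂ)⁻¹ * P.DM (P.phiM lam) P.θp)).choose_spec

theorem chiR_spec : IsSolution P.q lam P.θp P.b (P.chiR lam) ∧
    P.chiR lam P.b = lam * P.α₂' + P.α₂ ∧ P.DR (P.chiR lam) P.b = lam * P.α₁' + P.α₁ :=
  (P.existsR lam (right_mem_Icc.2 P.lt_b.le) (lam * P.α₂' + P.α₂)
    (lam * P.α₁' + P.α₁)).choose_spec

theorem chiM_spec : IsSolution P.q lam P.θm P.θp (P.chiM lam) ∧
    P.chiM lam P.θp = P.γ * (P.δ : ℂ)⁻¹ * P.chiR lam P.θp ∧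
    P.DM (P.chiM lam) P.θp = P.γ * (P.δ : ℂ)⁻¹ * P.DR (P.chiR lam) P.θp :=
  (P.existsM lam (right_mem_Icc.2 P.θm_lt.le) (P.γ * (P.δ : ℂ)⁻¹ * P.chiR lam P.θp)
    (P.γ * (P.δ : ℂ)⁻¹ * P.DR (P.chiR lam) P.θp)).choose_spec

theorem chiL_spec : IsSolution P.q lam P.a P.θm (P.chiL lam) ∧
    P.chiL lam P.θm = P.δ * P.chiM lam P.θm ∧
    P.DL (P.chiL lam) P.θm = P.δ * P.DM (P.chiM lam) P.θm :=
  (P.existsL lam (right_mem_Icc.2 P.a_lt.le) (P.δ * P.chiM lam P.θm)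
    (P.δ * P.DM (P.chiM lam) P.θm)).choose_spec

theorem δ_ne' : (P.δ : ℂ) ≠ 0 := Complex.ofReal_ne_zero.2 P.δ_ne

theorem γ_ne' : (P.γ : ℂ) ≠ 0 := Complex.ofReal_ne_zero.2 P.γ_ne

/-- The solution `φ`, glued. -/
noncomputable def phi : ℝ → ℂ := P.glue (P.phiL lam) (P.phiM lam) (P.phiR lam)

/-- The derivative of the glued solution `φ`. -/
noncomputable def dphi : ℝ → ℂ :=
  P.glue (P.DL (P.phiL lam)) (P.DM (P.phiM lam)) (P.DR (P.phiR lam))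

theorem phi_transmission : P.phiL lam P.θm = P.δ * P.phiM lam P.θm ∧
    P.DL (P.phiL lam) P.θm = P.δ * P.DM (P.phiM lam) P.θm ∧
    P.δ * P.phiM lam P.θp = P.γ * P.phiR lam P.θp ∧
    P.δ * P.DM (P.phiM lam) P.θp = P.γ * P.DR (P.phiR lam) P.θp := by
  have h1 := P.δ_ne'
  have h2 := P.γ_ne'
  rw [(P.phiM_spec lam).2.1, (P.phiM_spec lam).2.2, (P.phiR_spec lam).2.1, (P.phiR_spec lam).2.2]
  refine ⟨?_, ?_, ?_, ?_⟩ <;> field_simp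

theorem isSolOff_phi :
    IsSolOff P.potential P.jumps lam P.a P.b (P.phi lam) (P.dphi lam) :=
  P.isSolOff_glue (P.phiL_spec lam).1 (P.phiM_spec lam).1 (P.phiR_spec lam).1
    (P.phi_transmission lam).1 (P.phi_transmission lam).2.1 (P.phi_transmission lam).2.2.1
    (P.phi_transmission lam).2.2.2

theorem phi_a : P.phi lam P.a = P.β₂ := by rw [phi, glue_a, (P.phiL_spec lam).2.1]

theorem dphi_a : P.dphi lam P.a = -P.β₁ := by rw [dphi, glue_a, (P.phiL_spec lam).2.2]

/-- The Wronskian in terms of the Cauchy data of `φ` at `b`. -/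
theorem omega_eq : P.omega lam = P.γ * (P.phi lam P.b * (lam * P.α₁' + P.α₁) -
    P.dphi lam P.b * (lam * P.α₂' + P.α₂)) := by
  have h1 := P.δ_ne'
  have h2 := P.γ_ne'
  have hchi := P.isSolOff_glue (P.chiL_spec lam).1 (P.chiM_spec lam).1 (P.chiR_spec lam).1
    (P.chiL_spec lam).2.1 (P.chiL_spec lam).2.2
    (by rw [(P.chiM_spec lam).2.1]; field_simp) (by rw [(P.chiM_spec lam).2.2]; field_simp)
  have hw := (P.isSolOff_phi lam).wronskian_eq P.a_lt_b.le hchi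
  rw [glue_a, glue_a, glue_b, glue_b, (P.chiR_spec lam).2.1, (P.chiR_spec lam).2.2] at hw
  rw [phi, dphi, glue_a, glue_a] at hw
  rw [omega, hw, ← phi, ← dphi]
  ring

theorem β_ne' : ¬(P.β₁ = 0 ∧ P.β₂ = 0) := fun h => P.β_ne (by simp [h.1, h.2])

/-- A solution which satisfies the boundary condition at `a` is a multiple of `φ`. -/
theorem exists_eq_mul_phi {u v : ℝ → ℂ}
    (h : IsSolOff P.potential P.jumps lam P.a P.b u v) (h0 : P.β₁ * u P.a + P.β₂ * v P.a = 0) :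
    ∃ c, ∀ x ∈ Icc P.a P.b, u x = c * P.phi lam x ∧ v x = c * P.dphi lam x := by
  obtain ⟨M, hM⟩ := P.potential_bounded_and_integrable.1
  have hβ : ((P.β₁ : ℂ) ^ 2 + (P.β₂ : ℂ) ^ 2) ≠ 0 := by
    intro h
    norm_cast at h
    refine P.β_ne' ⟨?_, ?_⟩ <;> nlinarith [sq_nonneg P.β₁, sq_nonneg P.β₂]
  -- The Cauchy data of u at a are proportional to (β₂, -β₁); the factor is read off by projecting
  -- onto that vector.
  refine ⟨(P.β₂ * u P.a - P.β₁ * v P.a) / ((P.β₁ : ℂ) ^ 2 + (P.β₂ : ℂ) ^ 2), fun x hx =>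
    h.eqOn ((P.isSolOff_phi lam).const_mul _) (fun x _ _ => hM x) ?_ ?_ hx⟩
  · rw [phi_a]
    field_simp
    linear_combination P.β₁ * h0
  · rw [dphi_a]
    field_simp
    linear_combination P.β₂ * h0

/-- If φ vanished there, continuity up to a would give β₁ = β₂ = 0. -/
theorem exists_phi_ne_zero : ∃ x ∈ Ioo P.a P.θm, P.phi lam x ≠ 0 := by
  by_contra! h
  have hsol := (P.isSolOff_phi lam).mono le_rfl (P.θm_lt.trans P.lt_b).le
  have hd : ∀ x ∈ Ioo P.a P.θm, P.dphi lam x = 0 := fun x hx => by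
    have h1 := hsol.hasDeriv x hx (by
      simp only [jumps, Finset.mem_insert, Finset.mem_singleton, not_or]
      exact ⟨hx.2.ne, (hx.2.trans P.θm_lt).ne⟩)
    refine h1.unique ((hasDerivAt_const x (0 : ℂ)).congr_of_eventuallyEq ?_)
    filter_upwards [Ioo_mem_nhds hx.1 hx.2] with t ht using h t ht
  have hlim : ∀ {f : ℝ → ℂ}, ContinuousOn f (Icc P.a P.θm) → (∀ x ∈ Ioo P.a P.θm, f x = 0) →
      f P.a = 0 := fun {f} hf h0 => by
    have h1 : EqOn f 0 (Icc P.a P.θm) := by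
      refine EqOn.of_subset_closure (s := Ioo P.a P.θm) (fun x hx => h0 x hx) hf
        continuousOn_const Ioo_subset_Icc_self ?_
      rw [closure_Ioo P.a_lt.ne]
    exact h1 (left_mem_Icc.2 P.a_lt.le)
  have h1 := hlim hsol.cont h
  have h2 := hlim hsol.cont' hd
  rw [phi_a] at h1
  rw [dphi_a] at h2
  refine P.β_ne' ⟨?_, ?_⟩
  · simpa using h2
  · simpa using h1

/-- An eigenfunction, glued, is cφ with c ≠ 0, and γ² times the boundary expression at b for φ is
ω(λ). -/
theorem isEigenvalue_iff : P.IsEigenvalue lam ↔ P.omega lam = 0 := by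
  have hγ := P.γ_ne'
  have hδ := P.δ_ne'
  constructor
  · rintro ⟨uL, uM, uR, hL, hM, hR, h1, h2, h3, h4, h5, h6, hne⟩
    have hu := P.isSolOff_glue hL hM hR (sub_eq_zero.1 h3) (sub_eq_zero.1 h4) (sub_eq_zero.1 h5)
      (sub_eq_zero.1 h6)
    obtain ⟨c, hc⟩ := P.exists_eq_mul_phi lam hu (by rw [glue_a, glue_a]; exact h1)
    have hc0 : c ≠ 0 := by
      rintro rfl
      simp only [zero_mul] at hc
      have hM0 : ∀ x ∈ Ioc P.θm P.θp, uM x = 0 := fun x hx => by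
        have := (hc x ⟨(P.a_lt.trans hx.1).le, (hx.2.trans_lt P.lt_b).le⟩).1
        rw [P.glue_of_mem _ _ _ hx] at this
        exact (mul_eq_zero.1 this).resolve_left hδ
      have hR0 : ∀ x ∈ Ioc P.θp P.b, uR x = 0 := fun x hx => by
        have := (hc x ⟨(P.a_lt.trans (P.θm_lt.trans hx.1)).le, hx.2⟩).1
        rw [P.glue_of_gt _ _ _ hx.1] at this
        exact (mul_eq_zero.1 this).resolve_left hγ
      have hL0 : ∀ x ∈ Icc P.a P.θm, uL x = 0 := fun x hx => by
        have := (hc x ⟨hx.1, (hx.2.trans_lt (P.θm_lt.trans P.lt_b)).le⟩).1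
        rwa [P.glue_of_le _ _ _ hx.2] at this
      -- The glued function takes its value at a jump from the piece on the left; the value of the
      -- right piece is recovered from the transmission condition.
      refine hne ⟨hL0, fun x hx => ?_, fun x hx => ?_⟩
      · rcases hx.1.eq_or_lt with rfl | h
        · rw [hL0 _ (right_mem_Icc.2 P.a_lt.le), zero_sub, neg_eq_zero] at h3
          exact (mul_eq_zero.1 h3).resolve_left hδ
        · exact hM0 x ⟨h, hx.2⟩
      · rcases hx.1.eq_or_lt with rfl | h
        · rw [hM0 _ (right_mem_Ioc.2 P.θm_lt), mul_zero, zero_sub, neg_eq_zero] at h5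
          exact (mul_eq_zero.1 h5).resolve_left hγ
        · exact hR0 x ⟨h, hx.2⟩
    obtain ⟨e1, e2⟩ := hc P.b (right_mem_Icc.2 P.a_lt_b.le)
    rw [glue_b] at e1 e2
    have : c * P.omega lam = 0 := by
      rw [omega_eq]
      linear_combination P.γ ^ 2 * h2 - P.γ * (lam * P.α₁' + P.α₁) * e1 +
        P.γ * (lam * P.α₂' + P.α₂) * e2
    exact (mul_eq_zero.1 this).resolve_left hc0
  · intro h
    obtain ⟨t1, t2, t3, t4⟩ := P.phi_transmission lam
    refine ⟨P.phiL lam, P.phiM lam, P.phiR lam, (P.phiL_spec lam).1, (P.phiM_spec lam).1,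
      (P.phiR_spec lam).1, ?_, ?_, sub_eq_zero.2 t1, sub_eq_zero.2 t2, sub_eq_zero.2 t3,
      sub_eq_zero.2 t4, ?_⟩
    · rw [(P.phiL_spec lam).2.1, (P.phiL_spec lam).2.2]
      ring
    · rw [omega_eq, phi, dphi, glue_b, glue_b] at h
      have : (P.γ : ℂ) ^ 2 * (lam * (P.α₁' * P.phiR lam P.b - P.α₂' * P.DR (P.phiR lam) P.b) +
          (P.α₁ * P.phiR lam P.b - P.α₂ * P.DR (P.phiR lam) P.b)) = 0 := by
        linear_combination h
      exact (mul_eq_zero.1 this).resolve_left (pow_ne_zero 2 hγ)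
    · rintro ⟨h0, -, -⟩
      obtain ⟨x, hx, hxne⟩ := P.exists_phi_ne_zero lam
      rw [phi, P.glue_of_le _ _ _ hx.2.le] at hxne
      exact hxne (h0 x (Ioo_subset_Icc_self hx))

/-- The energy estimate with σ = |s|: since ||s|² - s²| = 2|s||Im s|, the energy grows at rate 2|Im
s| + M/|s|, and the square root halves it. For |s| ≤ 1 the choice σ = 1 serves. -/
theorem exists_norm_phi_le : ∃ C, 0 ≤ C ∧ ∀ s : ℂ, ∀ x ∈ Icc P.a P.b,
    ‖P.phi (s ^ 2) x‖ ≤ C * Real.exp ((P.b - P.a) * |s.im|) := by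
  obtain ⟨M, hM⟩ := P.potential_bounded_and_integrable.1
  have hM0 : 0 ≤ M := (abs_nonneg _).trans (hM 0)
  have hL : 0 < P.b - P.a := sub_pos.2 P.a_lt_b
  set B := P.β₁ ^ 2 + P.β₂ ^ 2 with hB
  have hB0 : 0 ≤ B := by positivity
  refine ⟨√(Real.exp ((2 + M) * (P.b - P.a)) * B), Real.sqrt_nonneg _, fun s x hx => ?_⟩
  have hxa : 0 ≤ x - P.a := sub_nonneg.2 hx.1
  have hxb : x - P.a ≤ P.b - P.a := by linarith [hx.2]
  have hen : ∀ σ : ℝ, 1 ≤ σ → (‖(σ : ℂ) ^ 2 - s ^ 2‖ + M) / σ ≤ 2 + M + 2 * |s.im| →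
      ‖P.phi (s ^ 2) x‖ ^ 2 ≤ Real.exp ((2 + M + 2 * |s.im|) * (P.b - P.a)) * B := by
    intro σ hσ hk
    have hσ0 : 0 < σ := by linarith
    have h1 := (P.isSolOff_phi (s ^ 2)).energy_le hσ0 (fun x _ _ => hM x) hx
    rw [phi_a, dphi_a, norm_neg, Complex.norm_real, Complex.norm_real, Real.norm_eq_abs,
      Real.norm_eq_abs, sq_abs, sq_abs] at h1
    have h2 : P.β₁ ^ 2 + σ ^ 2 * P.β₂ ^ 2 ≤ σ ^ 2 * B := by
      rw [hB, mul_add]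
      gcongr
      exact le_mul_of_one_le_left (sq_nonneg _) (one_le_pow₀ hσ)
    have h3 : σ ^ 2 * ‖P.phi (s ^ 2) x‖ ^ 2 ≤
        σ ^ 2 * (Real.exp ((2 + M + 2 * |s.im|) * (P.b - P.a)) * B) := by
      calc σ ^ 2 * ‖P.phi (s ^ 2) x‖ ^ 2
          ≤ ‖P.dphi (s ^ 2) x‖ ^ 2 + σ ^ 2 * ‖P.phi (s ^ 2) x‖ ^ 2 :=
            le_add_of_nonneg_left (sq_nonneg _)
        _ ≤ _ := h1
        _ ≤ Real.exp ((2 + M + 2 * |s.im|) * (P.b - P.a)) * (σ ^ 2 * B) := by gcongr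
        _ = _ := by ring
    exact le_of_mul_le_mul_left h3 (by positivity)
  have key : ‖P.phi (s ^ 2) x‖ ^ 2 ≤ Real.exp ((2 + M + 2 * |s.im|) * (P.b - P.a)) * B := by
    rcases le_total 1 ‖s‖ with hs | hs
    · refine hen ‖s‖ hs ?_
      have h1 : ((‖s‖ : ℝ) : ℂ) ^ 2 - s ^ 2 = -(s * (2 * s.im * Complex.I)) := by
        have := Complex.sub_conj s
        push_cast at this
        rw [← Complex.mul_conj', ← this]
        ring
      have h2 : ‖((‖s‖ : ℝ) : ℂ) ^ 2 - s ^ 2‖ = ‖s‖ * (2 * |s.im|) := by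
        rw [h1]
        simp
      rw [h2, div_le_iff₀ (by linarith)]
      nlinarith
    · refine hen 1 le_rfl ?_
      have h1 : ‖((1 : ℝ) : ℂ) ^ 2 - s ^ 2‖ ≤ 2 := by
        refine (norm_sub_le _ _).trans ?_
        rw [norm_pow, norm_pow]
        have : ‖s‖ ^ 2 ≤ 1 := pow_le_one₀ (norm_nonneg _) hs
        simp
        linarith
      have := abs_nonneg s.im
      linarith
  have he : Real.exp ((2 + M + 2 * |s.im|) * (P.b - P.a)) * B =
      (√(Real.exp ((2 + M) * (P.b - P.a)) * B) * Real.exp ((P.b - P.a) * |s.im|)) ^ 2 := by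
    rw [mul_pow, Real.sq_sqrt (by positivity), ← Real.exp_nat_mul, mul_right_comm, ← Real.exp_add]
    congr 2
    push_cast
    ring
  rw [he] at key
  exact le_of_sq_le_sq key (by positivity)

end Problem

end SL

namespace SL

namespace Problem

open scoped ComplexConjugate

variable (P : Problem)

/-! ### The Hilbert space L²(a, b) ⊕ ℂ and the kernel formula. -/

/-- The boundary value `α₁' φ(b) - α₂' φ'(b)`. -/
noncomputable def bdry (lam : ℂ) : ℂ := P.α₁' * P.phi lam P.b - P.α₂' * P.dphi lam P.b

theorem phi_continuous (lam : ℂ) : Continuous fun x : Icc P.a P.b => P.phi lam x :=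
  continuousOn_iff_continuous_domRestrict.1 (P.isSolOff_phi lam).cont

/-- The glued solution `φ` as a continuous function on `[a, b]`. -/
noncomputable def phiC (lam : ℂ) : C(Icc P.a P.b, ℂ) :=
  ⟨fun x => P.phi lam x, P.phi_continuous lam⟩

theorem differentiable_phiC :
    Differentiable ℂ P.phiC ∧ Differentiable ℂ fun lam => P.dphi lam P.b := by
  obtain ⟨⟨M, hM⟩, hi⟩ := P.potential_bounded_and_integrable
  exact differentiable_of_isSolOff P.a_lt_b.le (fun c d => hi.intervalIntegrable) hM
    P.isSolOff_phi P.phi_a P.dphi_a fun lam x => rfl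

theorem differentiable_phi_b : Differentiable ℂ fun lam => P.phi lam P.b := by
  let e : C(Icc P.a P.b, ℂ) →L[ℂ] ℂ :=
    ContinuousMap.evalCLM ℂ ⟨P.b, right_mem_Icc.2 P.a_lt_b.le⟩
  exact e.differentiable.comp P.differentiable_phiC.1

theorem differentiable_bdry : Differentiable ℂ P.bdry :=
  (P.differentiable_phi_b.const_mul _).sub (P.differentiable_phiC.2.const_mul _)

theorem differentiable_omega : Differentiable ℂ P.omega := by
  have h1 := P.differentiable_phi_b
  have h2 := P.differentiable_phiC.2
  have h : P.omega = fun lam => P.γ * (P.phi lam P.b * (lam * P.α₁' + P.α₁) -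
      P.dphi lam P.b * (lam * P.α₂' + P.α₂)) := funext P.omega_eq
  rw [h]
  fun_prop

/-- Lebesgue measure on `[a, b]`. -/
noncomputable def vol : Measure (Icc P.a P.b) := Measure.comap Subtype.val volume

theorem measurePreserving_coe :
    MeasurePreserving Subtype.val P.vol (volume.restrict (Icc P.a P.b)) :=
  measurePreserving_subtype_coe measurableSet_Icc

instance : IsFiniteMeasure P.vol := by
  refine ⟨?_⟩
  have h := P.measurePreserving_coe.measure_preimage MeasurableSet.univ.nullMeasurableSet
  rw [preimage_univ] at h
  rw [h]
  simp

/-- The Hilbert space `L²(a, b) ⊕ ℂ`. -/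
abbrev Hilb : Type := WithLp 2 (Lp ℂ 2 P.vol × ℂ)

/-- The constant `ρ`. -/
def rho : ℝ := P.α₁' * P.α₂ - P.α₁ * P.α₂'

theorem rho_pos : 0 < P.rho := P.ρ_pos

/-- The solution `φ` together with its boundary value, as a vector of `L²(a, b) ⊕ ℂ`. -/
noncomputable def vec (lam : ℂ) : P.Hilb :=
  WithLp.toLp 2 (ContinuousMap.toLp 2 P.vol ℂ (P.phiC lam),
    ((√P.rho)⁻¹ : ℝ) * P.bdry lam)

theorem differentiable_vec : Differentiable ℂ P.vec := by
  let T : C(Icc P.a P.b, ℂ) →L[ℂ] Lp ℂ 2 P.vol := ContinuousMap.toLp 2 P.vol ℂ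
  have h1 : Differentiable ℂ fun lam => (T (P.phiC lam), ((√P.rho)⁻¹ : ℝ) * P.bdry lam) :=
    (T.differentiable.comp P.differentiable_phiC.1).prodMk (P.differentiable_bdry.const_mul _)
  exact (WithLp.prodContinuousLinearEquiv 2 ℂ (Lp ℂ 2 P.vol)
    ℂ).symm.differentiable.comp h1

theorem integral_Icc_eq (f : ℝ → ℂ) :
    ∫ x : Icc P.a P.b, f x ∂P.vol = ∫ x in P.a..P.b, f x := by
  rw [vol, integral_subtype_comap measurableSet_Icc, integral_Icc_eq_integral_Ioc,
    intervalIntegral.integral_of_le P.a_lt_b.le]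

theorem inner_vec (z w : ℂ) : inner ℂ (P.vec w) (P.vec z) =
    (∫ x in P.a..P.b, P.phi z x * conj (P.phi w x)) +
      (P.rho : ℂ)⁻¹ * (P.bdry z * conj (P.bdry w)) := by
  rw [WithLp.prod_inner_apply]
  congr 1
  · rw [← P.integral_Icc_eq fun x => P.phi z x * conj (P.phi w x)]
    simp only [vec]
    rw [L2.inner_def]
    refine integral_congr_ae ?_
    filter_upwards [ContinuousMap.coeFn_toLp (p := 2) (𝕜 := ℂ) P.vol (P.phiC z),
      ContinuousMap.coeFn_toLp (p := 2) (𝕜 := ℂ) P.vol (P.phiC w)] with x h1 h2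
    rw [h1, h2, RCLike.inner_apply]
    rfl
  · have h : ((P.rho : ℝ) : ℂ)⁻¹ = ((√P.rho)⁻¹ : ℝ) * ((√P.rho)⁻¹ : ℝ) := by
      rw [← Complex.ofReal_mul, ← mul_inv, Real.mul_self_sqrt P.rho_pos.le, Complex.ofReal_inv]
    simp only [vec]
    rw [RCLike.inner_apply, map_mul, Complex.conj_ofReal, h]
    ring

/-- A relation between the vectors holds almost everywhere for the functions, hence everywhere by
continuity. It serves both nonvanishing and linear independence. -/
theorem phi_eq_zero_of_sum {ι : Type*} (s : Finset ι) (k mu : ι → ℂ)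
    (h : ∑ i ∈ s, k i • P.vec (mu i) = 0) :
    ∀ x ∈ Icc P.a P.b, ∑ i ∈ s, k i * P.phi (mu i) x = 0 := by
  have h1 : ContinuousMap.toLp 2 P.vol ℂ
      (∑ i ∈ s, k i • P.phiC (mu i)) = 0 := by
    have h2 := congrArg (fun x =>
      (WithLp.prodContinuousLinearEquiv 2 ℂ (Lp ℂ 2 P.vol) ℂ x).1) h
    simp only [map_sum, map_smul, map_zero, Prod.fst_sum, Prod.smul_fst, Prod.fst_zero] at h2 ⊢
    exact h2
  have h3 : ∀ᵐ x : Icc P.a P.b ∂P.vol, ∑ i ∈ s, k i * P.phi (mu i) x = 0 := by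
    filter_upwards [ContinuousMap.coeFn_toLp (p := 2) (𝕜 := ℂ) P.vol
      (∑ i ∈ s, k i • P.phiC (mu i)), Lp.coeFn_zero ℂ 2 P.vol]
      with x hx hx0
    rw [h1, hx0] at hx
    simpa [ContinuousMap.sum_apply, phiC] using hx.symm
  have h4 := (ae_restrict_iff_subtype (p := fun x => ∑ i ∈ s, k i * P.phi (mu i) x = 0)
    (measurableSet_Icc (a := P.a) (b := P.b))).2 h3
  refine Measure.eqOn_Icc_of_ae_eq volume P.a_lt_b.ne (g := fun _ => 0) h4 ?_ continuousOn_const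
  exact continuousOn_finsetSum _ fun i _ => continuousOn_const.mul (P.isSolOff_phi _).cont

theorem linearIndependent_vec : LinearIndependent ℂ fun n : ℕ => P.vec n := by
  rw [linearIndependent_iff']
  intro s k hk
  have h0 := P.phi_eq_zero_of_sum s k (fun n => (n : ℂ)) hk
  have hsub : ∀ x ∈ Ioo P.a P.θm, x ∈ Ioo P.a P.b ∧ x ∉ P.jumps := fun x hx => by
    refine ⟨⟨hx.1, hx.2.trans (P.θm_lt.trans P.lt_b)⟩, ?_⟩
    simp only [jumps, Finset.mem_insert, Finset.mem_singleton, not_or]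
    exact ⟨hx.2.ne, (hx.2.trans P.θm_lt).ne⟩
  exact eq_zero_of_sum_mul_eq_zero (q := P.potential) (mu := fun n : ℕ => (n : ℂ))
    Nat.cast_injective
    (fun n x hx => (P.isSolOff_phi n).hasDeriv x (hsub x hx).1 (hsub x hx).2)
    (fun n x hx => (P.isSolOff_phi n).hasDeriv' x (hsub x hx).1 (hsub x hx).2)
    (fun n => P.exists_phi_ne_zero n) s k
    fun x hx => h0 x (Ioo_subset_Icc_self (hsub x hx).1)

theorem vec_ne_zero (z : ℂ) : P.vec z ≠ 0 := by
  intro h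
  have h0 := P.phi_eq_zero_of_sum {()} (fun _ => 1) (fun _ => z) (by simpa using h)
  obtain ⟨x, hx, hne⟩ := P.exists_phi_ne_zero z
  refine hne ?_
  simpa using h0 x ⟨hx.1.le, (hx.2.trans (P.θm_lt.trans P.lt_b)).le⟩

theorem norm_bdry_le (z : ℂ) : ‖P.bdry z‖ ≤ √P.rho * ‖P.vec z‖ := by
  have hr : 0 < √P.rho := Real.sqrt_pos.2 P.rho_pos
  have h1 := WithLp.prod_norm_sq_eq_of_L2 (P.vec z)
  have h2 : ‖(P.vec z).snd‖ ≤ ‖P.vec z‖ := by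
    refine le_of_sq_le_sq ?_ (norm_nonneg _)
    rw [h1]
    exact le_add_of_nonneg_left (sq_nonneg _)
  have h3 : (P.vec z).snd = ((√P.rho)⁻¹ : ℝ) * P.bdry z := rfl
  rw [h3, norm_mul, Complex.norm_real, Real.norm_eq_abs, abs_of_pos (inv_pos.2 hr),
    inv_mul_le_iff₀ hr] at h2
  exact h2

/-- The boundary term of Lagrange's identity at a vanishes, as φ has fixed real data there. With N =
α₁φ(b) - α₂φ'(b) and R = `bdry`, the term at b is (N(z) conj R(w) - R(z) conj N(w))/ρ. Adding (z -
w̄)R(z) conj R(w)/ρ replaces N by λR + N = ω/γ. -/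
theorem isKernelFamily : IsKernelFamily P.vec P.omega
    (fun z => (P.γ * P.rho : ℂ)⁻¹ * P.bdry z) (‖(P.γ * P.rho : ℂ)⁻¹‖ * √P.rho) where
  differentiable := P.differentiable_vec
  differentiable_omega := P.differentiable_omega
  ne_zero := P.vec_ne_zero
  norm_le z := by
    rw [norm_mul, mul_assoc]
    gcongr
    exact P.norm_bdry_le z
  kernel z w := by
    have hγ := P.γ_ne'
    have hρ : (P.rho : ℂ) ≠ 0 := Complex.ofReal_ne_zero.2 P.rho_pos.ne'
    have hl := (P.isSolOff_phi z).lagrange P.a_lt_b.le (P.isSolOff_phi w).conjugate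
    simp only [phi_a, dphi_a, map_neg, Complex.conj_ofReal] at hl
    rw [inner_vec, mul_add, hl, omega_eq, omega_eq, bdry, bdry]
    simp only [map_mul, map_sub, map_add, map_inv₀, Complex.conj_ofReal]
    field_simp
    simp only [rho]
    push_cast
    ring

/-! ### The zeros of ω are bounded below and form a sequence. -/

/-- For very negative t, φ grows so fast that 2⟨φ(b), φ'(b)⟩ ≥ m‖φ(b)‖², whereas ω(t) = 0 forces
(tα₁' + α₁)φ(b) = (tα₂' + α₂)φ'(b). These are incompatible: by size if α₂' ≠ 0, by sign if α₂' = 0.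
-/
theorem exists_lower_bound : ∃ m : ℝ, ∀ t : ℝ, P.omega t = 0 → m ≤ t := by
  obtain ⟨M, hM⟩ := P.potential_bounded_and_integrable.1
  have hL : 0 < P.b - P.a := sub_pos.2 P.a_lt_b
  -- The summands serve, in order, the length condition, the initial condition of the growth lemma,
  -- and the final contradiction when α₂' ≠ 0. Division by zero gives 0, which is harmless when β₂
  -- or α₂' vanishes.
  set m := 1 / (P.b - P.a) + 2 * |P.β₁| / |P.β₂| + 4 * (|P.α₁'| + |P.α₁|) / |P.α₂'| + 1 with hm
  have p1 : 0 < 1 / (P.b - P.a) := by positivity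
  have p2 : 0 ≤ 2 * |P.β₁| / |P.β₂| := by positivity
  have p3 : 0 ≤ 4 * (|P.α₁'| + |P.α₁|) / |P.α₂'| := by positivity
  have hm0 : 0 < m := by linarith
  have hm1 : 1 ≤ m * (P.b - P.a) := by
    have : 1 / (P.b - P.a) ≤ m := by linarith
    rwa [div_le_iff₀ hL] at this
  have hm2 : 2 * |P.β₁ * P.β₂| ≤ m * P.β₂ ^ 2 := by
    by_cases hβ : P.β₂ = 0
    · simp [hβ]
    · have hβ' : 0 < |P.β₂| := abs_pos.2 hβ
      have h1 : 2 * |P.β₁| / |P.β₂| ≤ m := by linarith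
      rw [div_le_iff₀ hβ'] at h1
      rw [abs_mul, ← sq_abs P.β₂]
      nlinarith
  -- Below this threshold q - t ≥ 2m², tρ + α₁α₂ < 0, |tα₂'| ≥ 2|α₂| if α₂' ≠ 0, and |t| ≥ 1.
  refine ⟨-(2 * m ^ 2 + |M| + |P.α₁ * P.α₂| / P.rho + 2 * |P.α₂| / |P.α₂'| + 1), fun t ht => ?_⟩
  by_contra! hlt
  have q1 : 0 ≤ |P.α₁ * P.α₂| / P.rho := div_nonneg (abs_nonneg _) P.rho_pos.le
  have q2 : 0 ≤ 2 * |P.α₂| / |P.α₂'| := by positivity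
  have q3 := le_abs_self M
  have q4 := abs_nonneg M
  have q5 := sq_nonneg m
  have hgrow := (P.isSolOff_phi t).mul_norm_sq_le_two_mul_inner P.a_lt_b.le hm1 hm0
    (fun x _ _ => by
      have := (abs_le.1 (hM x)).1
      linarith) (by
      rw [phi_a, dphi_a]
      have : inner ℝ (P.β₂ : ℂ) (-(P.β₁ : ℂ)) = -(P.β₁ * P.β₂) := by
        rw [Complex.inner]
        simp
      rw [this, abs_neg, Complex.norm_real, Real.norm_eq_abs, sq_abs]
      exact hm2)
  have hr : P.bdry t ≠ 0 :=
    right_ne_zero_of_mul (P.isKernelFamily.ne_zero_of_omega_eq_zero ht).1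
  rw [omega_eq] at ht
  have hAB := (mul_eq_zero.1 ht).resolve_left P.γ_ne'
  rw [bdry] at hr
  set u := P.phi t P.b
  set v := P.dphi t P.b
  set A := t * P.α₁' + P.α₁ with hA
  set B := t * P.α₂' + P.α₂ with hBdef
  have hAB' : (A : ℂ) * u = B * v := by
    rw [hA, hBdef]
    push_cast
    linear_combination hAB
  have hin : A * ‖u‖ ^ 2 = B * inner ℝ u v := by
    have := congrArg (fun w => inner ℝ u w) hAB'
    simp only [← Complex.real_smul, real_inner_smul_right, real_inner_self_eq_norm_sq] at this
    exact this
  have hN : 0 ≤ inner ℝ u v := by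
    have : 0 ≤ m * ‖u‖ ^ 2 := by positivity
    linarith
  have hu : B ≠ 0 → 0 < ‖u‖ ^ 2 := fun hB => by
    refine pow_pos (norm_pos_iff.2 fun hu => ?_) 2
    rw [hu, mul_zero] at hAB'
    have hv : v = 0 := (mul_eq_zero.1 hAB'.symm).resolve_left (Complex.ofReal_ne_zero.2 hB)
    exact hr (by rw [hu, hv]; simp)
  by_cases hα : P.α₂' = 0
  · have hρ : P.rho = P.α₁' * P.α₂ := by rw [rho, hα]; ring
    have hρ0 := P.rho_pos
    have hα₂ : P.α₂ ≠ 0 := fun h => by rw [hρ, h, mul_zero] at hρ0; exact hρ0.false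
    have hB : B = P.α₂ := by rw [hBdef, hα]; ring
    have hu' := hu (hB ▸ hα₂)
    -- Multiplying by α₂ brings in ρ = α₁'α₂, whose sign is known.
    have h1 : (t * P.rho + P.α₁ * P.α₂) * ‖u‖ ^ 2 = P.α₂ ^ 2 * inner ℝ u v := by
      rw [hB] at hin
      rw [hρ]
      linear_combination P.α₂ * hin
    have h2 : 0 ≤ (t * P.rho + P.α₁ * P.α₂) * ‖u‖ ^ 2 := by rw [h1]; positivity
    have h3 : 0 ≤ t * P.rho + P.α₁ * P.α₂ := nonneg_of_mul_nonneg_left h2 hu'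
    have h4 : t < -(|P.α₁ * P.α₂| / P.rho) := by linarith
    rw [← neg_div, lt_div_iff₀ hρ0] at h4
    linarith [le_abs_self (P.α₁ * P.α₂)]
  · have hα' : 0 < |P.α₂'| := abs_pos.2 hα
    have ht1 : 1 ≤ |t| := by
      have := neg_abs_le t
      linarith
    have ht2 : 2 * |P.α₂| ≤ |t| * |P.α₂'| := by
      rw [← div_le_iff₀ hα']
      have := neg_abs_le t
      linarith
    have hB1 : |t| * |P.α₂'| ≤ 2 * |B| := by
      have h1 : |t * P.α₂'| ≤ |B| + |P.α₂| := by
        have : t * P.α₂' = B - P.α₂ := by rw [hBdef]; ring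
        rw [this]
        exact abs_sub _ _
      rw [abs_mul] at h1
      linarith
    have hB0 : B ≠ 0 := fun h => by
      rw [h, abs_zero, mul_zero] at hB1
      have : 0 < |t| * |P.α₂'| := by positivity
      linarith
    have hA1 : |A| ≤ |t| * (|P.α₁'| + |P.α₁|) := by
      have h1 : |A| ≤ |t| * |P.α₁'| + |P.α₁| := by
        rw [hA, ← abs_mul]
        exact abs_add_le _ _
      nlinarith [abs_nonneg P.α₁]
    have hu' := hu hB0
    have h1 : |A| * ‖u‖ ^ 2 = |B| * inner ℝ u v := by
      rw [← abs_of_nonneg hu'.le, ← abs_mul, hin, abs_mul, abs_of_nonneg hN]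
    have h2 : |B| * (m * ‖u‖ ^ 2) ≤ |B| * (2 * inner ℝ u v) := by gcongr
    -- Growth gives |A|/|B| ≥ m/2, while |B| ≥ |tα₂'|/2 and |A| ≤ |t|(|α₁'| + |α₁|) bound that ratio
    -- by a quantity that m was chosen to exceed.
    have h3 : |B| * m ≤ 2 * |A| := by
      refine le_of_mul_le_mul_right ?_ hu'
      linarith
    have h4 : |t| * |P.α₂'| * m ≤ 2 * |B| * m := by gcongr
    have h5 : |t| * (|P.α₂'| * m) ≤ |t| * (4 * (|P.α₁'| + |P.α₁|)) := by linarith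
    have h6 : |P.α₂'| * m ≤ 4 * (|P.α₁'| + |P.α₁|) := le_of_mul_le_mul_left h5 (by linarith)
    have h7 : m ≤ 4 * (|P.α₁'| + |P.α₁|) / |P.α₂'| := by
      rw [le_div_iff₀ hα']
      linarith
    linarith

/-- The zeros of `ω` form an increasing sequence of real numbers. -/
theorem exists_zeros : ∃ lam : ℕ → ℝ, StrictMono lam ∧
    {z : ℂ | P.omega z = 0} = range fun n => (lam n : ℂ) := by
  have hk := P.isKernelFamily
  have hreal : {z : ℂ | P.omega z = 0} = (fun t : ℝ => (t : ℂ)) '' {t : ℝ | P.omega t = 0} := by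
    ext z
    constructor
    · intro hz
      have : ((z.re : ℝ) : ℂ) = z := Complex.ext rfl (by simp [hk.im_eq_zero hz])
      exact ⟨z.re, by rw [mem_ofPred_eq, this]; exact hz, this⟩
    · rintro ⟨t, ht, rfl⟩
      exact ht
  have hinf := hk.infinite_zeros P.linearIndependent_vec
  rw [hreal] at hinf
  obtain ⟨m, hm⟩ := P.exists_lower_bound
  obtain ⟨s, hs, hsZ⟩ := exists_strictMono_range_eq (Set.Infinite.of_image _ hinf)
    ⟨m, fun t ht => hm t ht⟩ hk.finite_zeros_inter
  refine ⟨s, hs, ?_⟩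
  rw [hreal, ← hsZ, ← range_comp]
  rfl

/-! ### The transform F as an inner product, and its growth. -/

/-- The weighted function `(g, δ g, γ g)`. -/
noncomputable def weighted (g : ℝ → ℂ) : ℝ → ℂ := P.glue g g g

variable {P} {g : ℝ → ℂ}

theorem memLp_weighted (hg : MemLp g 2 (volume.restrict (Ioo P.a P.b))) :
    MemLp (P.weighted g) 2 (volume.restrict (Icc P.a P.b)) := by
  rw [Measure.restrict_congr_set Ioo_ae_eq_Icc] at hg
  have he : P.weighted g = fun x => P.glue 1 1 1 x * g x := by
    funext x
    simp only [weighted, glue, Pi.one_apply]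
    split_ifs <;> ring
  have hmeas : Measurable (P.glue 1 1 1) :=
    Measurable.ite measurableSet_Iic measurable_one (Measurable.ite measurableSet_Iic
      (measurable_one.const_mul _) (measurable_one.const_mul _))
  refine hg.of_le_mul (c := 1 + |P.δ| + |P.γ|) ?_ (Eventually.of_forall fun x => ?_)
  · rw [he]
    exact hmeas.aestronglyMeasurable.mul hg.1
  · rw [he, norm_mul]
    gcongr
    have h1 := abs_nonneg P.δ
    have h2 := abs_nonneg P.γ
    simp only [glue, Pi.one_apply]
    split_ifs <;> simp <;> linarith

theorem integrableOn_weighted (hg : MemLp g 2 (volume.restrict (Ioo P.a P.b))) :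
    IntegrableOn (P.weighted g) (Icc P.a P.b) :=
  (memLp_weighted hg).integrable (by norm_num)

theorem F_eq_integral (hg : MemLp g 2 (volume.restrict (Ioo P.a P.b))) (lam : ℂ) :
    P.F g lam = ∫ x in P.a..P.b, P.weighted g x * P.phi lam x := by
  have hi : IntegrableOn (fun x => P.weighted g x * P.phi lam x) (Icc P.a P.b) :=
    (integrableOn_weighted hg).mul_continuousOn (P.isSolOff_phi lam).cont isCompact_Icc
  have hI : ∀ {c d : ℝ}, P.a ≤ c → c ≤ d → d ≤ P.b →
      IntervalIntegrable (fun x => P.weighted g x * P.phi lam x) volume c d := fun h1 h2 h3 =>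
    (intervalIntegrable_iff_integrableOn_Icc_of_le h2).2 (hi.mono_set (Icc_subset_Icc h1 h3))
  have l1 := P.a_lt.le
  have l2 := P.θm_lt.le
  have l3 := P.lt_b.le
  rw [← intervalIntegral.integral_add_adjacent_intervals (hI le_rfl (l1.trans l2) l3)
    (hI (l1.trans l2) l3 le_rfl), ← intervalIntegral.integral_add_adjacent_intervals
    (hI le_rfl l1 (l2.trans l3)) (hI l1 l2 l3), F, ← intervalIntegral.integral_const_mul,
    ← intervalIntegral.integral_const_mul]
  congr 1
  · congr 1
    · refine intervalIntegral.integral_congr_ae (Eventually.of_forall fun x hx => ?_)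
      rw [uIoc_of_le l1] at hx
      rw [weighted, phi, P.glue_of_le _ _ _ hx.2, P.glue_of_le _ _ _ hx.2]
    · refine intervalIntegral.integral_congr_ae (Eventually.of_forall fun x hx => ?_)
      rw [uIoc_of_le l2] at hx
      rw [weighted, phi, P.glue_of_mem _ _ _ hx, P.glue_of_mem _ _ _ hx]
      ring
  · refine intervalIntegral.integral_congr_ae (Eventually.of_forall fun x hx => ?_)
    rw [uIoc_of_le l3] at hx
    rw [weighted, phi, P.glue_of_gt _ _ _ hx.1, P.glue_of_gt _ _ _ hx.1]
    ring

/-- The transform `F` is the inner product with a fixed vector of `L²(a, b) ⊕ ℂ`. -/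
theorem exists_inner_vec_eq_F (hg : MemLp g 2 (volume.restrict (Ioo P.a P.b))) :
    ∃ x : P.Hilb, ∀ lam, inner ℂ x (P.vec lam) = P.F g lam := by
  have h1 : MemLp (fun x : Icc P.a P.b => conj (P.weighted g x)) 2 P.vol :=
    ((memLp_weighted hg).comp_measurePreserving
      P.measurePreserving_coe).star
  -- The zero component suppresses the boundary value; the conjugate compensates for the
  -- conjugate-linearity of `inner` in its first argument.
  refine ⟨WithLp.toLp 2 (h1.toLp _, 0), fun lam => ?_⟩
  rw [WithLp.prod_inner_apply, F_eq_integral hg, ← P.integral_Icc_eq]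
  simp only [vec, inner_zero_left, add_zero]
  rw [L2.inner_def]
  refine integral_congr_ae ?_
  filter_upwards [ContinuousMap.coeFn_toLp (p := 2) (𝕜 := ℂ) P.vol (P.phiC lam),
    h1.coeFn_toLp] with x hx1 hx2
  rw [hx1, hx2, RCLike.inner_apply, Complex.conj_conj, mul_comm]
  rfl

theorem exists_norm_F_sq_le (hg : MemLp g 2 (volume.restrict (Ioo P.a P.b))) :
    ∃ C : ℝ, 0 ≤ C ∧ ∀ s : ℂ, ‖P.F g (s ^ 2)‖ ≤ C * Real.exp ((P.b - P.a) * |s.im|) := by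
  obtain ⟨C, hC0, hC⟩ := P.exists_norm_phi_le
  have l := P.a_lt_b.le
  have hi := (intervalIntegrable_iff_integrableOn_Icc_of_le l).2 (integrableOn_weighted hg)
  refine ⟨(∫ x in P.a..P.b, ‖P.weighted g x‖) * C, mul_nonneg
    (intervalIntegral.integral_nonneg l fun x _ => norm_nonneg _) hC0, fun s => ?_⟩
  rw [F_eq_integral hg, mul_assoc, ← intervalIntegral.integral_mul_const]
  refine intervalIntegral.norm_integral_le_of_norm_le l (Eventually.of_forall fun x hx => ?_)
    (hi.norm.mul_const _)
  rw [norm_mul]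
  gcongr
  exact hC s x (Ioc_subset_Icc_self hx)

theorem exists_norm_F_le (hg : MemLp g 2 (volume.restrict (Ioo P.a P.b))) :
    ∃ C : ℝ, ∀ z : ℂ, ‖P.F g z‖ ≤ C * Real.exp ((P.b - P.a) * ‖z‖) := by
  obtain ⟨C, hC0, hC⟩ := exists_norm_F_sq_le hg
  have hL : 0 ≤ P.b - P.a := sub_nonneg.2 P.a_lt_b.le
  refine ⟨C * Real.exp (P.b - P.a), fun z => ?_⟩
  -- With z = s², |Im s| ≤ 1 + |s|² = 1 + |z|; the 1 accounts for the factor e^{b-a} in the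
  -- constant.
  obtain ⟨s, rfl⟩ := IsAlgClosed.exists_pow_nat_eq z two_pos
  refine (hC s).trans ?_
  rw [mul_assoc, ← Real.exp_add, norm_pow]
  gcongr
  have h1 := Complex.abs_im_le_norm s
  have h2 : |s.im| ≤ 1 + ‖s‖ ^ 2 := by nlinarith [sq_nonneg (‖s‖ - 1)]
  nlinarith

end Problem

end SL

theorem theorem1 (P : SL.Problem) :
    Differentiable ℂ P.omega ∧
    ∃ lam : ℕ → ℝ, StrictMono lam ∧
      {z : ℂ | P.IsEigenvalue z} = Set.range (fun n => (lam n : ℂ)) ∧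
      {z : ℂ | P.omega z = 0} = Set.range (fun n => (lam n : ℂ)) ∧
      (∀ n, deriv P.omega (lam n) ≠ 0) ∧
      ∀ g : ℝ → ℂ, MemLp g 2 (volume.restrict (Set.Ioo P.a P.b)) →
        Differentiable ℂ (P.F g) ∧
        (∃ C : ℝ, ∀ z : ℂ, ‖P.F g z‖ ≤ C * Real.exp ((P.b - P.a) * ‖z‖)) ∧
        (∃ C : ℝ, ∀ s : ℂ, ‖P.F g (s ^ 2)‖ ≤ C * Real.exp ((P.b - P.a) * |s.im|)) ∧
        (∀ z : ℂ, Summable fun n => ‖P.F g (lam n) * P.sampling (lam n) z‖) ∧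
        (∀ z : ℂ, HasSum (fun n => P.F g (lam n) * P.sampling (lam n) z) (P.F g z)) ∧
        ∀ K : Set ℂ, IsCompact K →
          TendstoUniformlyOn
            (fun N z => ∑ n ∈ Finset.range N, P.F g (lam n) * P.sampling (lam n) z)
            (P.F g) atTop K := by
  have hk := P.isKernelFamily
  obtain ⟨lam, hlam, hZ⟩ := P.exists_zeros
  refine ⟨P.differentiable_omega, lam, hlam, ?_, hZ,
    fun n => (hk.ne_zero_of_omega_eq_zero (hZ.ge ⟨n, rfl⟩)).2, fun g hg => ?_⟩
  · rw [← hZ]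
    exact Set.ext P.isEigenvalue_iff
  obtain ⟨x, hx⟩ := SL.Problem.exists_inner_vec_eq_F hg
  obtain ⟨hsum, hunif⟩ := hk.sampling_series hlam hZ x
  simp only [hx] at hsum hunif
  refine ⟨?_, SL.Problem.exists_norm_F_le hg, ?_, fun z => (hsum z).summable.norm, hsum, hunif⟩
  · have hd := (innerSL ℂ x).differentiable.comp hk.differentiable
    have he : P.F g = innerSL ℂ x ∘ P.vec := funext fun z => (hx z).symm
    rwa [he]
  · obtain ⟨C, -, hC⟩ := SL.Problem.exists_norm_F_sq_le hg
    exact ⟨C, hC⟩
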